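/- **Setting.** Let $(X_k)_{k\ge 0}$ be a time-homogeneous Harris ergodic (i.e. positive Harris recurrent and aperiodic) Markov chain on a measurable space $(\mathcal X,\mathcal B)$ with $\mathcal B$ countably generated, with transition kernel $P$ and stationary probability measure $\pi$. Write $\mathbf P_\mu$ for the law of the chain with initial distribution $\mu$, and $\mathbf P_x=\mathbf P_{\delta_x}$. Let $C\in\mathcal B$ with $\pi(C)>0$, a probability measure $\nu$ with $\nu(C)>0$, $\delta>0$ and an integer $m\ge 1$ satisfy $$P^m(x,B)\ge \delta\,\nu(B)\qquad (x\in C,\ B\in\mathcal B).$$ The split chain is the process $(X_n)_{n\ge0}$ together with levels $Y_k\in\{0,1\}$, $k\ge 0$, such that, conditionally on $X_0,\dots,X_{km}$ and $Y_0,\dots,Y_{k-1}$ with $X_{km}=x$, the law of $(X_{km+1},\dots,X_{(k+1)m})$ on the event $Y_k=1$ is $$1_C(x)\frac{\delta\nu(dy)}{P^m(x,dy)}P(x,dx_1)\cdots P(x_{m-1},dy),$$ and on the event $Y_k=0$ it is the same expression with $1_C(x)\frac{\delta\nu(dy)}{P^m(x,dy)}$ replaced by $1-1_C(x)\frac{\delta\nu(dy)}{P^m(x,dy)}$.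 Its law when $X_0\sim\mu$ is denoted by $\bar{\mathbf P}_{\mu^*}$ (so $(X_0,Y_0)\sim\mu^*$, where $\mu^*(A\times\{1\})=\delta\mu(A\cap C)$ and $\mu^*(A\times\{0\})=\mu(A)-\delta\mu(A\cap C)$), and $\bar{\mathbf P}_{x^*}=\bar{\mathbf P}_{\delta_x^*}$. For a measurable $f:\mathcal X\to\mathbb R$ put $Z_k=\sum_{j=0}^{m-1}f(X_{km+j})$, $\tau_C=\inf\{k\ge1: X_{km}\in C\}$, $\sigma=\sigma(0)=\min\{k\ge 0:Y_k=1\}$, $\sigma(i)=\min\{k>\sigma(i-1):Y_k=1\}$ for $i\ge1$, and $s_i=\sum_{j=\sigma(i)+1}^{\sigma(i+1)}Z_j$. For $\alpha\in(0,1]$ let $\|Y\|_{\psi_\alpha,\mu}=\inf\{c>0:\mathbf E_\mu\exp(|Y|^\alpha/c^\alpha)\le2\}\in[0,\infty]$, and define (values in $[0,\infty]$), for $x\in\mathcal X$, $$\mathbf a=\Big\|\sum_{i=0}^{\sigma}|Z_i|\Big\|_{\psi_\alpha,\bar{\mathbf P}_{x^*}},\qquad \mathbf b=\Big\|\sum_{i=0}^{\sigma}|Z_i|\Big\|_{\psi_\alpha,\bar{\mathbf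 P}_{\pi^*}},\qquad \mathbf c=\|s_i\|_{\psi_\alpha,\bar{\mathbf P}_{\mu^*}},$$ $$\mathcal A=\Big\|\sum_{i=0}^{\tau_C-1}|Z_i|\Big\|_{\psi_\alpha,\mathbf P_x},\qquad \mathcal B=\Big\|\sum_{i=0}^{\tau_C-1}|Z_i|\Big\|_{\psi_\alpha,\mathbf P_\pi},\qquad \mathcal D=\sup_{y\in C}\|Z_0\|_{\psi_\alpha,\mathbf P_y},$$ $$\mathcal C=\sup_{y\in C}\Big\|\sum_{i=1}^{\tau_C-1}|Z_i|\Big\|_{\psi_\alpha,\mathbf P_y},\qquad \mathcal C_0=\sup_{y\in C}\Big\|\sum_{i=1}^{\tau_C-1}Z_i\Big\|_{\psi_\alpha,\mathbf P_y}\ (\le\mathcal C).$$ **Proposition.** There is exactly one $r\ge 1$ with $$2^{1/r}\delta^{1-1/r}+2^{1+1/r}(1-\delta)^{1-1/r}=2$$ (where for $\delta=1$ the second summand is read as $0$, so that $r=1$), and for this $r$, every $\alpha\in(0,1]$, every measurable $f$ and every $x\in\mathcal X$, $$\mathbf a\le r^{1/\alpha}\big(\max\{\mathcal A,\mathcal C\}^\alpha+\mathcal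 D^\alpha\big)^{1/\alpha},\qquad \mathbf b\le r^{1/\alpha}\big(\max\{\mathcal B,\mathcal C\}^\alpha+\mathcal D^\alpha\big)^{1/\alpha},$$ and, for every $i\ge0$ and every initial probability measure $\mu$, $$\mathbf c\le r^{1/\alpha}\big(\mathcal C_0^\alpha+\mathcal D^\alpha\big)^{1/\alpha};\qquad\text{in particular}\quad \mathbf c\le r^{1/\alpha}\big(\mathcal C^\alpha+\mathcal D^\alpha\big)^{1/\alpha}.$$ -/

import Mathlib

open MeasureTheory ProbabilityTheory
open scoped ENNReal

noncomputable section

namespace SplitChain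

/-- The exponential Orlicz norm `‖Y‖_{ψ_α, μ} = inf {c > 0 : E_μ exp (|Y|^α / c^α) ≤ 2}`,
with values in `[0, ∞]` (it is `∞` if there is no such `c`). -/
def psiNorm {Ω : Type*} [MeasurableSpace Ω] (α : ℝ) (μ : Measure Ω) (Y : Ω → ℝ) : ℝ≥0∞ :=
  ⨅ (c : ℝ) (_ : 0 < c)
    (_ : ∫⁻ ω, ENNReal.ofReal (Real.exp (|Y ω| ^ α / c ^ α)) ∂μ ≤ 2), ENNReal.ofReal c

section Chain

variable {S : Type*} [MeasurableSpace S]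

/-- `pathLaw κ x` is the law `P_x` on path space of the time-homogeneous Markov chain with
transition kernel `κ` started at `x`. The law `P_μ` is `(pathLaw κ) ∘ₘ μ`. -/
def pathLaw (κ : Kernel S S) [IsMarkovKernel κ] : Kernel S (ℕ → S) :=
  (Kernel.traj (X := fun _ : ℕ => S)
      (fun n => κ.comap (fun h : (i : Finset.Iic n) → S => h ⟨n, Finset.mem_Iic.2 le_rfl⟩)
        (measurable_pi_apply _)) 0).comap
    (fun x _ => x) (measurable_pi_lambda _ fun _ => measurable_id)

instance (κ : Kernel S S) [IsMarkovKernel κ] : IsMarkovKernel (pathLaw κ) := by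
  unfold pathLaw; infer_instance

/-- The minorization condition `κ^m(x, B) ≥ δ ν(B)` for all `x ∈ C` and all measurable `B`. -/
def Minorizes (κ : Kernel S S) (m : ℕ) (C : Set S) (δ : ℝ) (ν : Measure S) : Prop :=
  ∀ x ∈ C, ∀ B, MeasurableSet B → ENNReal.ofReal δ * ν B ≤ (κ ^ m) x B

/-- Harris recurrence with respect to `π`: from every starting point, every set of positive
`π`-measure is visited infinitely often almost surely. -/
def HarrisRecurrent (κ : Kernel S S) [IsMarkovKernel κ] (π : Measure S) : Prop :=
  ∀ B, MeasurableSet B → 0 < π B → ∀ x,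
    ∀ᵐ ω ∂(pathLaw κ x), ∃ᶠ n in Filter.atTop, ω n ∈ B

/-- Aperiodicity: for some set `K` of positive `π`-measure and some probability measure `φ` with
`φ(K) > 0`, the set of all `n ≥ 1` such that `κ^n(x, ·) ≥ ε φ` on `K` for some `ε > 0` has
greatest common divisor `1`. -/
def Aperiodic (κ : Kernel S S) (π : Measure S) : Prop :=
  ∃ (K : Set S) (φ : Measure S), MeasurableSet K ∧ 0 < π K ∧ IsProbabilityMeasure φ ∧ 0 < φ K ∧
    ∀ d : ℕ, (∀ n : ℕ, 1 ≤ n → (∃ ε : ℝ, 0 < ε ∧ Minorizes κ n K ε φ) → d ∣ n) → d = 1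

/-- A Harris ergodic chain with stationary distribution `π`: positive Harris recurrent and
aperiodic. -/
structure HarrisErgodic (κ : Kernel S S) [IsMarkovKernel κ] (π : Measure S) : Prop where
  isProbabilityMeasure : IsProbabilityMeasure π
  invariant : κ.Invariant π
  harrisRecurrent : HarrisRecurrent κ π
  aperiodic : Aperiodic κ π

/-- `Z_k(f) = ∑_{j=0}^{m-1} f(X_{km+j})`. -/
def Z (m : ℕ) (f : S → ℝ) (X : ℕ → S) (k : ℕ) : ℝ :=
  ∑ j ∈ Finset.range m, f (X (k * m + j))

/-- `τ_C = inf {k ≥ 1 : X_{km} ∈ C}` (`0` if there is no such `k`; this event is null for a Harris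
ergodic chain and `C` of positive stationary measure). -/
def tauC (m : ℕ) (C : Set S) (X : ℕ → S) : ℕ :=
  sInf {k : ℕ | 1 ≤ k ∧ X (k * m) ∈ C}

/-- `‖∑_{i=0}^{τ_C-1} |Z_i(f)|‖_{ψ_α, P_μ}`: this is `𝓐` for `μ = δ_x` and `𝓑` for `μ = π`. -/
def calAB (κ : Kernel S S) [IsMarkovKernel κ] (m : ℕ) (C : Set S) (f : S → ℝ) (α : ℝ)
    (μ : Measure S) : ℝ≥0∞ :=
  psiNorm α ((pathLaw κ) ∘ₘ μ) fun X => ∑ i ∈ Finset.range (tauC m C X), |Z m f X i|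

/-- `𝓒 = sup_{x ∈ C} ‖∑_{i=1}^{τ_C-1} |Z_i(f)|‖_{ψ_α, P_x}`. -/
def calC (κ : Kernel S S) [IsMarkovKernel κ] (m : ℕ) (C : Set S) (f : S → ℝ) (α : ℝ) : ℝ≥0∞ :=
  ⨆ x ∈ C, psiNorm α (pathLaw κ x) fun X => ∑ i ∈ Finset.Ico 1 (tauC m C X), |Z m f X i|

/-- The version without absolute values, `𝓒₀ = sup_{x ∈ C} ‖∑_{i=1}^{τ_C-1} Z_i(f)‖_{ψ_α, P_x}`. -/
def calC₀ (κ : Kernel S S) [IsMarkovKernel κ] (m : ℕ) (C : Set S) (f : S → ℝ) (α : ℝ) : ℝ≥0∞ :=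
  ⨆ x ∈ C, psiNorm α (pathLaw κ x) fun X => ∑ i ∈ Finset.Ico 1 (tauC m C X), Z m f X i

/-- `𝓓 = sup_{x ∈ C} ‖Z_0(f)‖_{ψ_α, P_x}`. -/
def calD (κ : Kernel S S) [IsMarkovKernel κ] (m : ℕ) (C : Set S) (f : S → ℝ) (α : ℝ) : ℝ≥0∞ :=
  ⨆ x ∈ C, psiNorm α (pathLaw κ x) fun X => Z m f X 0

/-! ### The split chain -/

/-- The law of `(X_0, …, X_m)` under `P_x`. -/
def blockLaw (κ : Kernel S S) [IsMarkovKernel κ] (m : ℕ) : Kernel S (Fin (m + 1) → S) :=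
  (pathLaw κ).map fun X i => X i

instance (κ : Kernel S S) [IsMarkovKernel κ] (m : ℕ) : IsMarkovKernel (blockLaw κ m) := by
  unfold blockLaw
  exact Kernel.IsMarkovKernel.map _ (measurable_pi_lambda _ fun i => measurable_pi_apply _)

/-- The splitting density `1_C(x) δ ν(dy) / P^m(x, dy)`, in a jointly measurable version. Under the
minorization condition it is at most `1` for `P^m(x, ·)`-almost every `y`, so that the truncation
at `1` then changes nothing but the choice of the version. -/
def splitDensity [MeasurableSpace.CountablyGenerated S] (κ : Kernel S S) [IsMarkovKernel κ]
    (m : ℕ) (C : Set S) (δ : ℝ) (ν : Measure S) (x y : S) : ℝ≥0∞ :=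
  min 1 (C.indicator
    (fun x => ENNReal.ofReal δ * Kernel.rnDeriv (Kernel.const S ν) (κ ^ m) x y) x)

theorem measurable_splitDensity [MeasurableSpace.CountablyGenerated S] (κ : Kernel S S)
    [IsMarkovKernel κ] (m : ℕ) {C : Set S} (hC : MeasurableSet C) (δ : ℝ) (ν : Measure S) :
    Measurable (Function.uncurry fun (x : S) (w : Fin (m + 1) → S) =>
      splitDensity κ m C δ ν x (w (Fin.last m))) := by
  have h1 : Measurable fun p : S × (Fin (m + 1) → S) =>
      ENNReal.ofReal δ *
        Kernel.rnDeriv (Kernel.const S ν) (κ ^ m) p.1 (p.2 (Fin.last m)) :=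
    measurable_const.mul ((Kernel.measurable_rnDeriv _ _).comp
      (measurable_fst.prodMk ((measurable_pi_apply (Fin.last m)).comp measurable_snd)))
  have h2 : (Function.uncurry fun (x : S) (w : Fin (m + 1) → S) =>
      splitDensity κ m C δ ν x (w (Fin.last m))) = fun p : S × (Fin (m + 1) → S) =>
        min 1 ((Prod.fst ⁻¹' C).indicator (fun p : S × (Fin (m + 1) → S) => ENNReal.ofReal δ *
          Kernel.rnDeriv (Kernel.const S ν) (κ ^ m) p.1 (p.2 (Fin.last m))) p) := by
    funext p
    by_cases hp : p.1 ∈ C <;> simp [Function.uncurry, splitDensity, Set.indicator, hp]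
  rw [h2]
  exact measurable_const.min (h1.indicator (measurable_fst hC))

/-- The joint law of `(Y_0, (X_0, …, X_m))` for the split chain with `X_0 = x`: on `Y_0 = 1`
(`true`) it is `1_C(x) (δ ν(dy) / P^m(x, dy)) P(x, dx_1) ⋯ P(x_{m-1}, dy)`, and on `Y_0 = 0`
(`false`) it is `(1 - 1_C(x) δ ν(dy) / P^m(x, dy)) P(x, dx_1) ⋯ P(x_{m-1}, dy)`. -/
def splitBlock [MeasurableSpace.CountablyGenerated S] (κ : Kernel S S) [IsMarkovKernel κ]
    (m : ℕ) (C : Set S) (δ : ℝ) (ν : Measure S) : Kernel S (Bool × (Fin (m + 1) → S)) :=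
  (Kernel.withDensity (blockLaw κ m)
      fun x w => splitDensity κ m C δ ν x (w (Fin.last m))).map (fun w => (true, w)) +
  (Kernel.withDensity (blockLaw κ m)
      fun x w => 1 - splitDensity κ m C δ ν x (w (Fin.last m))).map (fun w => (false, w))

theorem isMarkovKernel_splitBlock [MeasurableSpace.CountablyGenerated S] (κ : Kernel S S)
    [IsMarkovKernel κ] (m : ℕ) {C : Set S} (hC : MeasurableSet C) (δ : ℝ) (ν : Measure S) :
    IsMarkovKernel (splitBlock κ m C δ ν) := by
  have hm := measurable_splitDensity κ m hC δ ν
  refine ⟨fun x => ⟨?_⟩⟩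
  have e1 : Measurable fun w : Fin (m + 1) → S => (true, w) := measurable_prodMk_left
  have e2 : Measurable fun w : Fin (m + 1) → S => (false, w) := measurable_prodMk_left
  have hx : Measurable fun w : Fin (m + 1) → S => splitDensity κ m C δ ν x (w (Fin.last m)) :=
    hm.comp measurable_prodMk_left
  rw [splitBlock, _root_.add_apply, Measure.add_apply, Kernel.map_apply' _ e1 _ MeasurableSet.univ,
    Kernel.map_apply' _ e2 _ MeasurableSet.univ, Kernel.withDensity_apply' _ hm,
    Kernel.withDensity_apply' _ (measurable_const.sub hm), Set.preimage_univ, Set.preimage_univ,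
    ← lintegral_add_left hx]
  have : ∀ w : Fin (m + 1) → S, splitDensity κ m C δ ν x (w (Fin.last m)) +
      (1 - splitDensity κ m C δ ν x (w (Fin.last m))) = 1 :=
    fun w => add_tsub_cancel_of_le (min_le_left _ _)
  simp [this]

/-- One step of the split chain on blocks `(Y_k, (X_{km}, …, X_{(k+1)m}))`: the next block depends
on the present one only through its last point `X_{(k+1)m}`. -/
def splitStep [MeasurableSpace.CountablyGenerated S] (κ : Kernel S S) [IsMarkovKernel κ]
    (m : ℕ) (C : Set S) (δ : ℝ) (ν : Measure S) :
    Kernel (Bool × (Fin (m + 1) → S)) (Bool × (Fin (m + 1) → S)) :=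
  (splitBlock κ m C δ ν).comap (fun e => e.2 (Fin.last m))
    ((measurable_pi_apply _).comp measurable_snd)

theorem isMarkovKernel_splitStep [MeasurableSpace.CountablyGenerated S] (κ : Kernel S S)
    [IsMarkovKernel κ] (m : ℕ) {C : Set S} (hC : MeasurableSet C) (δ : ℝ) (ν : Measure S) :
    IsMarkovKernel (splitStep κ m C δ ν) := by
  have := isMarkovKernel_splitBlock κ m hC δ ν
  unfold splitStep; infer_instance

/-- The law `P̄_{μ^*}` of the split chain, as the law of the sequence of blocks
`(Y_k, (X_{km}, …, X_{(k+1)m}))`, `k ≥ 0`, where `X_0` has distribution `μ` and, given `X_0`, the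
first block has the law `splitBlock`; so `(X_0, Y_0)` has distribution `μ^*`. -/
def splitLaw [MeasurableSpace.CountablyGenerated S] (κ : Kernel S S) [IsMarkovKernel κ]
    (m : ℕ) {C : Set S} (hC : MeasurableSet C) (δ : ℝ) (ν : Measure S) (μ : Measure S) :
    Measure (ℕ → Bool × (Fin (m + 1) → S)) :=
  haveI := isMarkovKernel_splitStep κ m hC δ ν
  (pathLaw (splitStep κ m C δ ν)) ∘ₘ ((splitBlock κ m C δ ν) ∘ₘ μ)

/-- The trajectory `(X_n)` read off from the blocks: for `m ≥ 1`, `X_{km+j}` with `j < m` is the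
`j`-th point of the `k`-th block. -/
def splitX {m : ℕ} (e : ℕ → Bool × (Fin (m + 1) → S)) (n : ℕ) : S :=
  (e (n / m)).2 (Fin.ofNat (m + 1) (n % m))

/-- The regeneration times `σ(0) = min {k ≥ 0 : Y_k = 1}`, `σ(i) = min {k > σ(i-1) : Y_k = 1}`
(`0` if there are fewer than `i + 1` times `k` with `Y_k = 1`; this event is null for a Harris
ergodic chain). -/
def sigma {m : ℕ} (e : ℕ → Bool × (Fin (m + 1) → S)) (i : ℕ) : ℕ :=
  Nat.nth (fun k => (e k).1 = true) i

/-- `s_i(f) = ∑_{j=σ(i)+1}^{σ(i+1)} Z_j(f)`. -/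
def excursionSum {m : ℕ} (f : S → ℝ) (e : ℕ → Bool × (Fin (m + 1) → S)) (i : ℕ) : ℝ :=
  ∑ j ∈ Finset.Ioc (sigma e i) (sigma e (i + 1)), Z m f (splitX e) j

/-- `‖∑_{i=0}^{σ} |Z_i(f)|‖_{ψ_α, P̄_{μ^*}}`: this is `𝐚` for `μ = δ_x` and `𝐛` for `μ = π`. -/
def boldAB [MeasurableSpace.CountablyGenerated S] (κ : Kernel S S) [IsMarkovKernel κ]
    (m : ℕ) {C : Set S} (hC : MeasurableSet C) (δ : ℝ) (ν : Measure S) (f : S → ℝ) (α : ℝ)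
    (μ : Measure S) : ℝ≥0∞ :=
  psiNorm α (splitLaw κ m hC δ ν μ) fun e =>
    ∑ i ∈ Finset.range (sigma e 0 + 1), |Z m f (splitX e) i|

/-- `‖s_i(f)‖_{ψ_α, P̄_{μ^*}}`; it depends neither on `i` nor on the initial distribution `μ`, and
is `𝐜`. -/
def boldC [MeasurableSpace.CountablyGenerated S] (κ : Kernel S S) [IsMarkovKernel κ]
    (m : ℕ) {C : Set S} (hC : MeasurableSet C) (δ : ℝ) (ν : Measure S) (f : S → ℝ) (α : ℝ)
    (μ : Measure S) (i : ℕ) : ℝ≥0∞ :=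
  psiNorm α (splitLaw κ m hC δ ν μ) fun e => excursionSum f e i

end Chain

/-- `r ≥ 1` solves `2^{1/r} δ^{1-1/r} + 2^{1+1/r} (1-δ)^{1-1/r} = 2`, where for `δ = 1` the second
summand is read as `0`. -/
def IsExponent (δ r : ℝ) : Prop :=
  1 ≤ r ∧ (2 : ℝ) ^ (1 / r) * δ ^ (1 - 1 / r) +
    (if δ = 1 then 0 else (2 : ℝ) ^ (1 + 1 / r) * (1 - δ) ^ (1 - 1 / r)) = 2

end SplitChain

end

noncomputable section

namespace SplitChain

/-! The proof is a geometric-series argument at the successive visits of the `m`-skeleton to `C`,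
run on exponential moments, with Hölder's inequality handling the dependence between a block, the
excursion after it and the regeneration variable.

Fix finite `k`, `d` strictly above the two suprema that control excursions and single blocks. Put `c
^ α = r * (k ^ α + d ^ α)`, `a = k ^ α / c ^ α`, `b = d ^ α / c ^ α`, so that `a + b = 1 / r`. With
`A`, `B`, `φ` the functions `exp (|s| ^ α / ·)` for `k`, `d`, `c`, one has `φ = A ^ a = B ^ b`, and
`φ` is submultiplicative because `α ≤ 1`. The moments of `A` over an excursion and of `B` over a
block started in `C` are at most `2`.

At a point of `C` the split density `D` has mean `δ`, and `1 - D` has mean `1 - δ`. As both are at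
most `1`, Hölder bounds the weight of "regenerate now" by `p = 2^b δ^(1-b)`, and that of "do not
regenerate, then return to `C`" by `q = 2^(a+b) (1-δ)^(1-(a+b))` (by `0` if `δ = 1`). Hence any `g`
with `p + q g ≤ g` bounds the moment from a visit to `C` up to regeneration (`lintegral_regFun_le`).
The equation for `r` says exactly that `g = 2^(1-a) δ^a` solves `p + q g = g`
(`recursion_constants`).

The stretch before the first visit costs `2^a` by Jensen, giving `2 δ^a ≤ 2` in total for the path
up to the first regeneration. For an excursion between regenerations, the stretch after a
regeneration block, weighted by `D`, costs `2^a δ^(1-a)`. Multiplied by `g` this is `2 δ`, twice the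
mass of `D`, so the moment is again at most `2`. Letting `k` and `d` decrease to the suprema
finishes the bound.

All functionals are truncated after `n` blocks, so the recursion is an induction on `n` without any
a priori finiteness. Fatou's lemma removes the truncation, provided that the split chain regenerates
infinitely often almost surely. That follows from two contraction arguments: aperiodicity makes the
skeleton hit `C` from every starting point, and each visit to `C` regenerates with probability `δ`.
-/

/-- Prepend a point to a path. -/
def consPath {E : Type*} (x : E) (ω : ℕ → E) : ℕ → E
  | 0 => x
  | n + 1 => ω n

/-- The path from time `n` on. -/
def shiftPath {E : Type*} (n : ℕ) (ω : ℕ → E) : ℕ → E := fun i => ω (n + i)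

@[simp] theorem consPath_zero {E : Type*} (x : E) (ω : ℕ → E) : consPath x ω 0 = x := rfl

@[simp] theorem consPath_succ {E : Type*} (x : E) (ω : ℕ → E) (n : ℕ) :
    consPath x ω (n + 1) = ω n := rfl

@[simp] theorem shiftPath_apply {E : Type*} (n i : ℕ) (ω : ℕ → E) :
    shiftPath n ω i = ω (n + i) := rfl

@[simp] theorem shiftPath_one_consPath {E : Type*} (x : E) (ω : ℕ → E) :
    shiftPath 1 (consPath x ω) = ω := by
  funext i; simp [shiftPath, Nat.add_comm 1 i]

/-! ### First-step analysis for the path law. -/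

section FirstStep

variable {E : Type*} [MeasurableSpace E]

theorem measurable_consPath : Measurable fun p : E × (ℕ → E) => consPath p.1 p.2 := by
  refine measurable_pi_lambda _ fun n => ?_
  cases n with
  | zero => exact measurable_fst
  | succ n => exact (measurable_pi_apply n).comp measurable_snd

theorem measurable_consPath_right (x : E) : Measurable (consPath x) :=
  measurable_consPath.comp measurable_prodMk_left

@[fun_prop]
theorem measurable_shiftPath (n : ℕ) : Measurable (shiftPath (E := E) n) :=
  measurable_pi_lambda _ fun _ => measurable_pi_apply _

variable (κ : Kernel E E) [IsMarkovKernel κ]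

theorem lintegral_pathLaw_mul_succ (x : E) (n : ℕ) {G : ((i : Finset.Iic n) → E) → ℝ≥0∞}
    (hG : Measurable G) {H : E → ℝ≥0∞} (hH : Measurable H) :
    ∫⁻ ω, G (fun i => ω i) * H (ω (n + 1)) ∂(pathLaw κ x) =
      ∫⁻ ω, G (fun i => ω i) * ∫⁻ y, H y ∂(κ (ω n)) ∂(pathLaw κ x) := by
  set κ' : (n : ℕ) → Kernel ((i : Finset.Iic n) → E) E := fun n =>
    κ.comap (fun h : (i : Finset.Iic n) → E => h ⟨n, Finset.mem_Iic.2 le_rfl⟩)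
        (measurable_pi_apply _) with hκ'
  have hP : pathLaw κ x = Kernel.traj (X := fun _ : ℕ => E) κ' 0 (fun _ => x) := rfl
  have h1 := Kernel.partialTraj_compProd_eq_map_traj (X := fun _ : ℕ => E) (κ := κ')
    (Nat.zero_le n) (x₀ := fun _ => x)
  have hGH : Measurable fun p : ((i : Finset.Iic n) → E) × E => G p.1 * H p.2 :=
    (hG.comp measurable_fst).mul (hH.comp measurable_snd)
  have h2 : ∫⁻ ω, G (fun i => ω i) * H (ω (n + 1)) ∂(pathLaw κ x) =
      ∫⁻ p, G p.1 * H p.2 ∂((Kernel.traj (X := fun _ : ℕ => E) κ' 0 (fun _ => x)).map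
        (fun ω => (Preorder.frestrictLe n ω, ω (n + 1)))) := by
    rw [lintegral_map hGH (by fun_prop), hP]; rfl
  rw [h2, ← h1, Measure.lintegral_compProd hGH, hP]
  rw [← Kernel.traj_map_frestrictLe_apply, lintegral_map _ (by fun_prop)]
  · refine lintegral_congr fun ω => ?_
    change ∫⁻ b, G (fun i => ω i) * H b ∂(κ (ω n)) = _
    exact lintegral_const_mul _ hH
  · exact hGH.lintegral_kernel_prod_right'

theorem ae_pathLaw_zero (x : E) {p : E → Prop} (hp : MeasurableSet {y | p y}) (h : p x) :
    ∀ᵐ ω ∂(pathLaw κ x), p (ω 0) := by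
  set κ' : (n : ℕ) → Kernel ((i : Finset.Iic n) → E) E := fun n =>
    κ.comap (fun h : (i : Finset.Iic n) → E => h ⟨n, Finset.mem_Iic.2 le_rfl⟩)
        (measurable_pi_apply _) with hκ'
  have hP : pathLaw κ x = Kernel.traj (X := fun _ : ℕ => E) κ' 0 (fun _ => x) := rfl
  have h1 := Kernel.traj_map_frestrictLe_apply (X := fun _ : ℕ => E) (κ := κ') 0 0 (fun _ => x)
  rw [Kernel.partialTraj_self, Kernel.id_apply] at h1
  have h2 : ∀ᵐ u ∂((Kernel.traj (X := fun _ : ℕ => E) κ' 0 (fun _ => x)).map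
      (Preorder.frestrictLe 0)), p (u ⟨0, by simp⟩) := by
    rw [h1, ae_dirac_iff]
    · exact h
    · exact measurable_pi_apply (⟨0, by simp⟩ : Finset.Iic 0) hp
  rw [hP]
  exact ae_of_ae_map (Preorder.measurable_frestrictLe (X := fun _ : ℕ => E) 0).aemeasurable h2

theorem lintegral_pathLaw_zero_mul (x : E) {g : E → ℝ≥0∞} (hg : Measurable g)
    {F : (ℕ → E) → ℝ≥0∞} (hF : Measurable F) :
    ∫⁻ ω, g (ω 0) * F ω ∂(pathLaw κ x) = g x * ∫⁻ ω, F ω ∂(pathLaw κ x) := by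
  rw [← lintegral_const_mul _ hF]
  refine lintegral_congr_ae ?_
  filter_upwards [ae_pathLaw_zero κ x (p := fun y => g y = g x)
    (hg (measurableSet_singleton _)) rfl] with ω h
  rw [h]

theorem lintegral_pathLaw_zero (x : E) {g : E → ℝ≥0∞} (hg : Measurable g) :
    ∫⁻ ω, g (ω 0) ∂(pathLaw κ x) = g x := by
  simpa using lintegral_pathLaw_zero_mul κ x hg (F := fun _ => 1) measurable_const

/-- The trajectory measure is built by adding a last coordinate, whereas first-step analysis splits
off the first one. Products of functions of single coordinates allow the exchange: `key` integrates
out the last coordinate, and the induction hypothesis then removes the first. -/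
theorem lintegral_pathLaw_prod (n : ℕ) (x : E) (g : ℕ → E → ℝ≥0∞) (hg : ∀ i, Measurable (g i)) :
    ∫⁻ ω, ∏ i ∈ Finset.range (n + 2), g i (ω i) ∂(pathLaw κ x) =
      g 0 x * ∫⁻ y, ∫⁻ ω, ∏ i ∈ Finset.range (n + 1), g (i + 1) (ω i) ∂(pathLaw κ y) ∂(κ x) := by
  have key : ∀ (n : ℕ) (x : E) (g : ℕ → E → ℝ≥0∞) (_ : ∀ i, Measurable (g i)),
      ∫⁻ ω, ∏ i ∈ Finset.range (n + 2), g i (ω i) ∂(pathLaw κ x) =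
      ∫⁻ ω, (∏ i ∈ Finset.range n, g i (ω i)) * (g n (ω n) * ∫⁻ y, g (n + 1) y ∂(κ (ω n)))
        ∂(pathLaw κ x) := by
    intro n x g hg
    have := lintegral_pathLaw_mul_succ κ x n
      (G := fun u => ∏ i : Finset.Iic n, g i (u i)) (by fun_prop) (hg (n + 1))
    have hprod : ∀ ω : ℕ → E, ∏ i : Finset.Iic n, g i (ω i) =
        ∏ i ∈ Finset.range (n + 1), g i (ω i) := by
      intro ω
      rw [Finset.prod_coe_sort (Finset.Iic n) (fun i => g i (ω i))]
      congr 1; ext i; simp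
    simp only [hprod] at this
    simp only [Finset.prod_range_succ _ (n + 1)]
    rw [this]
    simp only [Finset.prod_range_succ _ n, mul_assoc]
  induction n generalizing x g with
  | zero =>
    rw [key 0 x g hg]
    simp only [Finset.range_zero, Finset.prod_empty, one_mul, zero_add, Finset.range_one,
      Finset.prod_singleton]
    have h1 : Measurable fun y => ∫⁻ z, g 1 z ∂(κ y) := (hg 1).lintegral_kernel
    rw [lintegral_pathLaw_zero κ x (g := fun y => g 0 y * ∫⁻ z, g 1 z ∂(κ y)) ((hg 0).mul h1)]
    congr 1
    exact lintegral_congr fun y => (lintegral_pathLaw_zero κ y (hg 1)).symm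
  | succ n ih =>
    rw [key (n + 1) x g hg]
    -- The integral over the last coordinate is absorbed into the factor at time `n + 1`, which
    -- leaves a product one factor shorter.
    set g' : ℕ → E → ℝ≥0∞ :=
      Function.update g (n + 1) (fun y => g (n + 1) y * ∫⁻ z, g (n + 2) z ∂(κ y)) with hg'
    have hm : ∀ i, Measurable (g' i) := by
      intro i
      by_cases hi : i = n + 1
      · subst hi
        simp only [hg', Function.update_self]
        exact (hg _).mul (hg _).lintegral_kernel
      · simpa [hg', Function.update_of_ne hi] using hg i
    have hne : ∀ i < n + 1, g' i = g i := fun i hi => by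
      simp [hg', Function.update_of_ne hi.ne]
    have e1 : ∀ ω : ℕ → E, (∏ i ∈ Finset.range (n + 1), g i (ω i)) *
        (g (n + 1) (ω (n + 1)) * ∫⁻ y, g (n + 1 + 1) y ∂(κ (ω (n + 1)))) =
        ∏ i ∈ Finset.range (n + 2), g' i (ω i) := by
      intro ω
      rw [Finset.prod_range_succ _ (n + 1)]
      congr 1
      · exact Finset.prod_congr rfl fun i hi => by rw [hne i (Finset.mem_range.1 hi)]
      · simp [hg']
    simp only [e1]
    rw [ih x g' hm, hne 0 (Nat.succ_pos _)]
    congr 1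
    refine lintegral_congr fun y => ?_
    rw [key n y (fun i => g (i + 1)) (fun i => hg _)]
    refine lintegral_congr fun ω => ?_
    rw [Finset.prod_range_succ]
    congr 1
    · refine Finset.prod_congr rfl fun i hi => ?_
      rw [hne (i + 1) (Nat.succ_lt_succ (Finset.mem_range.1 hi))]
    · simp [hg']

/-- Both sides are finite measures of equal mass, so it suffices to compare them on the π-system of
cylinders, where the indicator is a finite product of coordinate functions. -/
theorem pathLaw_eq_comp_map (x : E) :
    pathLaw κ x = ((pathLaw κ).map (consPath x)) ∘ₘ (κ x) := by
  have hc := measurable_consPath_right x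
  have : IsMarkovKernel ((pathLaw κ).map (consPath x)) := Kernel.IsMarkovKernel.map _ hc
  refine ext_of_generate_finite _ (generateFrom_squareCylinders (α := fun _ : ℕ => E)).symm
    (isPiSystem_squareCylinders (fun _ => MeasurableSpace.isPiSystem_measurableSet) (by simp))
    ?_ (by simp)
  rintro A ⟨s, t, ht, rfl⟩
  simp only [Set.mem_pi, Set.mem_univ, forall_const, Set.mem_ofPred_eq] at ht
  have hA : MeasurableSet ((s : Set ℕ).pi t) :=
    MeasurableSet.pi (Finset.countable_toSet _) (fun i _ => ht i)
  classical
  set g : ℕ → E → ℝ≥0∞ := fun i => if i ∈ s then (t i).indicator 1 else 1 with hgdef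
  have hg : ∀ i, Measurable (g i) := by
    intro i
    by_cases hi : i ∈ s
    · simpa [hgdef, hi] using measurable_one.indicator (ht i)
    · simpa [hgdef, hi] using measurable_one
  obtain ⟨N, hN⟩ : ∃ N, ∀ i ∈ s, i < N + 2 :=
    ⟨s.sup id, fun i hi => lt_of_le_of_lt (Finset.le_sup (f := id) hi) (by simp)⟩
  have hind : ∀ ω : ℕ → E, ((s : Set ℕ).pi t).indicator 1 ω =
      ∏ i ∈ Finset.range (N + 2), g i (ω i) := by
    intro ω
    by_cases h : ω ∈ (s : Set ℕ).pi t
    · rw [Set.indicator_of_mem h, Finset.prod_eq_one]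
      · rfl
      intro i _
      by_cases hi : i ∈ s
      · simp [hgdef, hi, h i hi]
      · simp [hgdef, hi]
    · rw [Set.indicator_of_notMem h]
      simp only [Set.mem_pi, not_forall] at h
      obtain ⟨i, hi, hi'⟩ := h
      rw [Finset.prod_eq_zero (Finset.mem_range.2 (hN i hi))]
      simp [hgdef, Finset.mem_coe.1 hi, hi']
  rw [← lintegral_indicator_one hA, ← lintegral_indicator_one hA]
  have hm : Measurable (((s : Set ℕ).pi t).indicator (1 : (ℕ → E) → ℝ≥0∞)) :=
    measurable_one.indicator hA
  rw [Measure.lintegral_bind (Kernel.aemeasurable _) hm.aemeasurable]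
  simp only [Kernel.map_apply _ hc]
  simp_rw [lintegral_map hm hc, hind]
  rw [lintegral_pathLaw_prod κ N x g hg, ← lintegral_const_mul]
  · refine lintegral_congr fun y => ?_
    rw [← lintegral_const_mul _ (by fun_prop)]
    refine lintegral_congr fun ω => ?_
    rw [Finset.prod_range_succ' _ (N + 1), mul_comm]
    rfl
  · have : Measurable fun ω : ℕ → E => ∏ i ∈ Finset.range (N + 1), g (i + 1) (ω i) := by fun_prop
    exact this.lintegral_kernel

/-- First-step analysis for the path law. -/
theorem lintegral_pathLaw (x : E) {F : (ℕ → E) → ℝ≥0∞} (hF : Measurable F) :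
    ∫⁻ ω, F ω ∂(pathLaw κ x) =
      ∫⁻ y, ∫⁻ ω, F (consPath x ω) ∂(pathLaw κ y) ∂(κ x) := by
  have hc := measurable_consPath_right x
  conv_lhs => rw [pathLaw_eq_comp_map κ x]
  rw [Measure.lintegral_bind (Kernel.aemeasurable _) hF.aemeasurable]
  simp only [Kernel.map_apply _ hc, lintegral_map hF hc]

end FirstStep

/-! ### The Markov property at a fixed time. -/

/-- The path that follows `ω` before time `n` and `ω'` from time `n` on. -/
def splicePath {E : Type*} (n : ℕ) (ω ω' : ℕ → E) : ℕ → E :=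
  fun i => if i < n then ω i else ω' (i - n)

theorem consPath_splicePath {E : Type*} (n : ℕ) (x : E) (ω ω' : ℕ → E) :
    consPath x (splicePath n ω ω') = splicePath (n + 1) (consPath x ω) ω' := by
  funext i
  cases i with
  | zero => simp [splicePath]
  | succ i => simp [splicePath]

/-- The points of a path at the times `0, …, m`. -/
def initBlock {S : Type*} (m : ℕ) (X : ℕ → S) : Fin (m + 1) → S := fun i => X i

section Markov

variable {S : Type*} [MeasurableSpace S]

@[fun_prop]
theorem measurable_initBlock (m : ℕ) : Measurable (initBlock (S := S) m) :=
  measurable_pi_lambda _ fun _ => measurable_pi_apply _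

theorem measurable_splicePath (n : ℕ) :
    Measurable fun p : (ℕ → S) × (ℕ → S) => splicePath n p.1 p.2 := by
  refine measurable_pi_lambda _ fun i => ?_
  by_cases h : i < n
  · simp only [splicePath, h, if_true]; fun_prop
  · simp only [splicePath, h, if_false]; fun_prop

variable (κ : Kernel S S) [IsMarkovKernel κ]

theorem measurable_lintegral_splicePath (n : ℕ) {F : (ℕ → S) → ℝ≥0∞} (hF : Measurable F) :
    Measurable fun X : ℕ → S => ∫⁻ X', F (splicePath n X X') ∂(pathLaw κ (X n)) := by
  have h : Measurable (Function.uncurry fun (X : ℕ → S) (X' : ℕ → S) => F (splicePath n X X')) :=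
    hF.comp (measurable_splicePath n)
  exact h.lintegral_kernel_prod_right'
    (κ := (pathLaw κ).comap (fun X : ℕ → S => X n) (measurable_pi_apply n))

/-- The Markov property at time `n`. -/
theorem lintegral_pathLaw_splicePath (n : ℕ) (x : S) {F : (ℕ → S) → ℝ≥0∞} (hF : Measurable F) :
    ∫⁻ X, F X ∂(pathLaw κ x) =
      ∫⁻ X, ∫⁻ X', F (splicePath n X X') ∂(pathLaw κ (X n)) ∂(pathLaw κ x) := by
  induction n generalizing x F with
  | zero =>
    have h : ∀ X X' : ℕ → S, splicePath 0 X X' = X' := fun X X' => by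
      funext i; simp [splicePath]
    simp only [h]
    exact (lintegral_pathLaw_zero κ x (g := fun y => ∫⁻ X', F X' ∂(pathLaw κ y))
      hF.lintegral_kernel).symm
  | succ n ih =>
    rw [lintegral_pathLaw κ x hF,
      lintegral_pathLaw κ x (measurable_lintegral_splicePath κ (n + 1) hF)]
    refine lintegral_congr fun y => ?_
    have := ih y (hF.comp (measurable_consPath_right x))
    simpa only [Function.comp_apply, consPath_splicePath, consPath_succ] using this

theorem lintegral_blockLaw (m : ℕ) (x : S) {G : (Fin (m + 1) → S) → ℝ≥0∞} (hG : Measurable G) :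
    ∫⁻ w, G w ∂(blockLaw κ m x) = ∫⁻ X, G (initBlock m X) ∂(pathLaw κ x) := by
  change ∫⁻ w, G w ∂((pathLaw κ).map (initBlock m) x) = _
  rw [Kernel.map_apply _ (measurable_initBlock m), lintegral_map hG (measurable_initBlock m)]

/-- The Markov property at time `m`: given the first block, the chain restarts from its
last point. -/
theorem lintegral_pathLaw_block (m : ℕ) (x : S) {F : (Fin (m + 1) → S) → (ℕ → S) → ℝ≥0∞}
    (hF : Measurable (Function.uncurry F)) :
    ∫⁻ X, F (initBlock m X) (shiftPath m X) ∂(pathLaw κ x) =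
      ∫⁻ w, ∫⁻ X, F w X ∂(pathLaw κ (w (Fin.last m))) ∂(blockLaw κ m x) := by
  have hG : Measurable fun w : Fin (m + 1) → S =>
      ∫⁻ X, F w X ∂(pathLaw κ (w (Fin.last m))) :=
    hF.lintegral_kernel_prod_right' (κ := (pathLaw κ).comap
      (fun w : Fin (m + 1) → S => w (Fin.last m)) (measurable_pi_apply _))
  rw [lintegral_blockLaw κ m x hG]
  have hF' : Measurable fun X : ℕ → S =>
      F (initBlock m (splicePath m X (shiftPath m X))) (shiftPath m X) :=
    hF.comp (((measurable_initBlock m).comp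
      ((measurable_splicePath m).comp (measurable_id.prodMk (measurable_shiftPath m)))).prodMk
      (measurable_shiftPath m))
  have e : ∀ X : ℕ → S, splicePath m X (shiftPath m X) = X := by
    intro X; funext i
    by_cases h : i < m
    · simp [splicePath, h]
    · simp [splicePath, h, Nat.add_sub_cancel' (not_lt.1 h)]
  simp only [e] at hF'
  rw [lintegral_pathLaw_splicePath κ m x hF']
  refine lintegral_congr fun X => ?_
  have e1 : ∀ X' : ℕ → S, shiftPath m (splicePath m X X') = X' := by
    intro X'; funext i; simp [splicePath]
  simp only [e1]
  -- The block of the spliced path takes its last point from `X' 0`, not from `X m`. The map `u`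
  -- isolates this dependence; the two points agree under the law started at `X m`, as the
  -- first-step formula at the end makes explicit.
  set u : S → Fin (m + 1) → S := fun y i => if (i : ℕ) < m then X i else y with hu
  have hum : Measurable u := by
    refine measurable_pi_lambda _ fun i => ?_
    by_cases h : (i : ℕ) < m
    · simp [hu, h]
    · simpa [hu, h] using measurable_id'
  have e2 : ∀ X' : ℕ → S, initBlock m (splicePath m X X') = u (X' 0) := by
    intro X'; funext i
    by_cases h : (i : ℕ) < m
    · simp [initBlock, splicePath, hu, h]
    · simp [initBlock, splicePath, hu, h, Nat.sub_eq_zero_of_le (Nat.lt_succ_iff.1 i.2)]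
  have e3 : u (X m) = initBlock m X := by
    funext i
    by_cases h : (i : ℕ) < m
    · simp [initBlock, hu, h]
    · have : (i : ℕ) = m := le_antisymm (Nat.lt_succ_iff.1 i.2) (not_lt.1 h)
      simp [initBlock, hu, this]
  have e4 : initBlock m X (Fin.last m) = X m := by simp [initBlock]
  simp only [e2, e4]
  have h0 : Measurable fun X' : ℕ → S => F (u (X' 0)) X' :=
    hF.comp ((hum.comp (measurable_pi_apply 0)).prodMk measurable_id)
  have h1 : Measurable fun X' : ℕ → S => F (u (X m)) X' := hF.comp measurable_prodMk_left
  rw [lintegral_pathLaw κ (X m) h0, ← e3, lintegral_pathLaw κ (X m) h1]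
  rfl

theorem lintegral_pow_eq (n : ℕ) (x : S) {g : S → ℝ≥0∞} (hg : Measurable g) :
    ∫⁻ y, g y ∂((κ ^ n) x) = ∫⁻ X, g (X n) ∂(pathLaw κ x) := by
  induction n generalizing x with
  | zero =>
    rw [lintegral_pathLaw_zero κ x hg, pow_zero]
    change ∫⁻ y, g y ∂(Kernel.id x) = g x
    rw [Kernel.id_apply, lintegral_dirac' x hg]
  | succ n ih =>
    rw [lintegral_pathLaw κ x (by fun_prop), pow_succ]
    change ∫⁻ y, g y ∂(((κ ^ n) ∘ₖ κ) x) = _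
    rw [Kernel.lintegral_comp _ _ _ hg]
    exact lintegral_congr fun y => ih y

theorem lintegral_blockLaw_last (m : ℕ) (x : S) {g : S → ℝ≥0∞} (hg : Measurable g) :
    ∫⁻ w, g (w (Fin.last m)) ∂(blockLaw κ m x) = ∫⁻ y, g y ∂((κ ^ m) x) := by
  rw [lintegral_blockLaw κ m x (by fun_prop), lintegral_pow_eq κ m x hg]
  simp [initBlock]

instance isMarkovKernel_pow (n : ℕ) : IsMarkovKernel (κ ^ n) := by
  induction n with
  | zero => rw [pow_zero]; exact inferInstanceAs (IsMarkovKernel Kernel.id)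
  | succ n ih => rw [pow_succ]; exact inferInstanceAs (IsMarkovKernel ((κ ^ n) ∘ₖ κ))

end Markov

/-! ### The split chain as a kernel, and the mass of the split density. -/

section Split

variable {S : Type*} [MeasurableSpace S] [MeasurableSpace.CountablyGenerated S]
  (κ : Kernel S S) [IsMarkovKernel κ] (m : ℕ) {C : Set S} (δ : ℝ) (ν : Measure S)

theorem splitDensity_le_one (x y : S) : splitDensity κ m C δ ν x y ≤ 1 := min_le_left _ _

theorem splitDensity_of_notMem {x : S} (hx : x ∉ C) (y : S) :
    splitDensity κ m C δ ν x y = 0 := by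
  simp [splitDensity, hx]

theorem lintegral_splitBlock (hC : MeasurableSet C) (x : S)
    {G : Bool × (Fin (m + 1) → S) → ℝ≥0∞} (hG : Measurable G) :
    ∫⁻ e, G e ∂(splitBlock κ m C δ ν x) =
      ∫⁻ w, (splitDensity κ m C δ ν x (w (Fin.last m)) * G (true, w) +
        (1 - splitDensity κ m C δ ν x (w (Fin.last m))) * G (false, w)) ∂(blockLaw κ m x) := by
  have hm := measurable_splitDensity κ m hC δ ν
  have e1 : Measurable fun w : Fin (m + 1) → S => (true, w) := measurable_prodMk_left
  have e2 : Measurable fun w : Fin (m + 1) → S => (false, w) := measurable_prodMk_left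
  have hx : Measurable fun w : Fin (m + 1) → S => splitDensity κ m C δ ν x (w (Fin.last m)) :=
    hm.comp measurable_prodMk_left
  rw [splitBlock, _root_.add_apply, lintegral_add_measure, Kernel.map_apply _ e1,
    Kernel.map_apply _ e2, lintegral_map hG e1, lintegral_map hG e2,
    Kernel.lintegral_withDensity _ hm _ (g := fun w => G (true, w)) (hG.comp e1),
    Kernel.lintegral_withDensity _ (measurable_const.sub hm) _ (g := fun w => G (false, w))
      (hG.comp e2)]
  exact (lintegral_add_left (hx.mul (hG.comp e1)) _).symm

variable {δ ν}

/-- Minorization makes `ν` absolutely continuous with respect to `P^m(x, ·)` and the density of `δ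
ν` almost surely at most `1`. So the truncation by `min 1` is invisible, and the density integrates
to the mass of `δ ν`. -/
theorem lintegral_splitDensity [IsProbabilityMeasure ν] (hδ : 0 < δ) (hmin : Minorizes κ m C δ ν)
    {x : S} (hx : x ∈ C) :
    ∫⁻ w, splitDensity κ m C δ ν x (w (Fin.last m)) ∂(blockLaw κ m x) = ENNReal.ofReal δ := by
  have hle : ENNReal.ofReal δ • ν ≤ (κ ^ m) x :=
    Measure.le_iff.2 fun B hB => by simpa using hmin x hx B hB
  have hδ0 : ENNReal.ofReal δ ≠ 0 := by simpa using hδ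
  have hac : ν ≪ (κ ^ m) x := (Measure.absolutelyContinuous_smul hδ0).trans hle.absolutelyContinuous
  have h1 : (Kernel.rnDeriv (Kernel.const S ν) (κ ^ m) x) =ᵐ[(κ ^ m) x] ν.rnDeriv ((κ ^ m) x) := by
    simpa using Kernel.rnDeriv_eq_rnDeriv_measure (κ := Kernel.const S ν) (η := κ ^ m) (a := x)
  have h2 : (ENNReal.ofReal δ • ν).rnDeriv ((κ ^ m) x) ≤ᵐ[(κ ^ m) x] 1 :=
    Measure.rnDeriv_le_one_of_le hle
  have h3 := Measure.rnDeriv_smul_left_of_ne_top ν ((κ ^ m) x) (ENNReal.ofReal_ne_top (r := δ))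
  have hms : Measurable (splitDensity κ m C δ ν x) := by
    unfold splitDensity
    simp only [Set.indicator_of_mem hx]
    exact measurable_const.min (measurable_const.mul (Kernel.measurable_rnDeriv_right _ _ _))
  rw [lintegral_blockLaw_last κ m x hms]
  have : ∫⁻ y, splitDensity κ m C δ ν x y ∂((κ ^ m) x) =
      ∫⁻ y, ENNReal.ofReal δ * ν.rnDeriv ((κ ^ m) x) y ∂((κ ^ m) x) := by
    refine lintegral_congr_ae ?_
    filter_upwards [h1, h2, h3] with y hy1 hy2 hy3
    simp only [splitDensity, Set.indicator_of_mem hx, hy1]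
    rw [hy3] at hy2
    exact min_eq_right (by simpa using hy2)
  rw [this, lintegral_const_mul _ (Measure.measurable_rnDeriv _ _),
    Measure.lintegral_rnDeriv hac]
  simp

theorem lintegral_one_sub_splitDensity (hC : MeasurableSet C)
    [IsProbabilityMeasure ν] (hδ : 0 < δ)
    (hmin : Minorizes κ m C δ ν) {x : S} (hx : x ∈ C) :
    ∫⁻ w, (1 - splitDensity κ m C δ ν x (w (Fin.last m))) ∂(blockLaw κ m x) =
      ENNReal.ofReal (1 - δ) := by
  have hm : Measurable fun w : Fin (m + 1) → S => splitDensity κ m C δ ν x (w (Fin.last m)) :=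
    (measurable_splitDensity κ m hC δ ν).comp measurable_prodMk_left
  have h := lintegral_splitDensity κ m hδ hmin hx
  rw [lintegral_sub hm (by rw [h]; exact ENNReal.ofReal_ne_top)
    (ae_of_all _ fun w => splitDensity_le_one κ m δ ν x _), h,
    ENNReal.ofReal_sub _ hδ.le]
  simp

theorem Minorizes.le_one {S : Type*} [MeasurableSpace S] {κ : Kernel S S} [IsMarkovKernel κ]
    {m : ℕ} {C : Set S} {δ : ℝ} {ν : Measure S} [IsProbabilityMeasure ν]
    (hmin : Minorizes κ m C δ ν) (hne : C.Nonempty) : δ ≤ 1 := by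
  obtain ⟨x, hx⟩ := hne
  have := hmin x hx Set.univ MeasurableSet.univ
  have h1 : IsMarkovKernel (κ ^ m) := isMarkovKernel_pow κ m
  simpa using this

variable (δ ν)

/-- The law of the split chain as a kernel in the starting point. -/
def splitKernel (hC : MeasurableSet C) : Kernel S (ℕ → Bool × (Fin (m + 1) → S)) :=
  haveI := isMarkovKernel_splitStep κ m hC δ ν
  (pathLaw (splitStep κ m C δ ν)) ∘ₖ (splitBlock κ m C δ ν)

theorem isMarkovKernel_splitKernel (hC : MeasurableSet C) :
    IsMarkovKernel (splitKernel κ m δ ν hC) := by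
  have := isMarkovKernel_splitStep κ m hC δ ν
  have := isMarkovKernel_splitBlock κ m hC δ ν
  unfold splitKernel; infer_instance

theorem splitLaw_eq (hC : MeasurableSet C) (μ : Measure S) :
    splitLaw κ m hC δ ν μ = splitKernel κ m δ ν hC ∘ₘ μ := by
  rw [splitLaw, splitKernel, Measure.comp_assoc]

theorem lintegral_splitLaw (hC : MeasurableSet C) (μ : Measure S)
    {F : (ℕ → Bool × (Fin (m + 1) → S)) → ℝ≥0∞}
    (hF : Measurable F) :
    ∫⁻ e, F e ∂(splitLaw κ m hC δ ν μ) = ∫⁻ x, ∫⁻ e, F e ∂(splitKernel κ m δ ν hC x) ∂μ := by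
  rw [splitLaw_eq, Measure.lintegral_bind (Kernel.aemeasurable _) hF.aemeasurable]

/-- First-step analysis for the split chain. -/
theorem lintegral_splitKernel (hC : MeasurableSet C) (x : S)
    {F : (ℕ → Bool × (Fin (m + 1) → S)) → ℝ≥0∞}
    (hF : Measurable F) :
    ∫⁻ e, F e ∂(splitKernel κ m δ ν hC x) =
      ∫⁻ e₀, ∫⁻ e, F (consPath e₀ e) ∂(splitKernel κ m δ ν hC (e₀.2 (Fin.last m)))
        ∂(splitBlock κ m C δ ν x) := by
  have := isMarkovKernel_splitStep κ m hC δ ν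
  rw [splitKernel, Kernel.lintegral_comp _ _ _ hF]
  refine lintegral_congr fun e₀ => ?_
  have hc : Measurable fun e => F (consPath e₀ e) := hF.comp (measurable_consPath_right e₀)
  rw [lintegral_pathLaw _ _ hF, Kernel.lintegral_comp _ _ _ hc]
  rfl

theorem measurable_lintegral_consPath (hC : MeasurableSet C)
    {F : (ℕ → Bool × (Fin (m + 1) → S)) → ℝ≥0∞}
    (hF : Measurable F) :
    Measurable fun e₀ : Bool × (Fin (m + 1) → S) =>
      ∫⁻ e, F (consPath e₀ e) ∂(splitKernel κ m δ ν hC (e₀.2 (Fin.last m))) := by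
  have := isMarkovKernel_splitKernel κ m δ ν hC
  have h : Measurable (Function.uncurry fun (e₀ : Bool × (Fin (m + 1) → S))
    (e : ℕ → Bool × (Fin (m + 1) → S)) => F (consPath e₀ e)) := hF.comp measurable_consPath
  exact h.lintegral_kernel_prod_right' (κ := (splitKernel κ m δ ν hC).comap
    (fun e₀ : Bool × (Fin (m + 1) → S) => e₀.2 (Fin.last m)) (by fun_prop))

end Split

/-! ### Recurrence of the `m`-skeleton. -/

theorem eq_zero_of_le_mul {c M : ℝ≥0∞} (hc : c < 1) (hM : M ≠ ∞) (h : M ≤ c * M) : M = 0 := by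
  by_contra h0
  have : c * M < 1 * M := by gcongr
  rw [one_mul] at this
  exact absurd h (not_le.2 this)

section Recurrence

variable {S : Type*} [MeasurableSpace S]

/-- The paths that avoid `C` at all times congruent to `-ρ` modulo `m`. -/
def avoiding (m : ℕ) (C : Set S) (ρ : ℕ) : Set (ℕ → S) := {X | ∀ n, m ∣ n + ρ → X n ∉ C}

theorem measurableSet_avoiding (m : ℕ) {C : Set S} (hC : MeasurableSet C) (ρ : ℕ) :
    MeasurableSet (avoiding m C ρ) := by
  have : avoiding m C ρ = ⋂ n : ℕ, ⋂ _ : m ∣ n + ρ, (fun X : ℕ → S => X n) ⁻¹' Cᶜ := by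
    ext X; simp [avoiding]
  rw [this]
  exact MeasurableSet.iInter fun n => MeasurableSet.iInter fun _ => measurable_pi_apply n hC.compl

variable (κ : Kernel S S) [IsMarkovKernel κ]

theorem pathLaw_apply (x : S) {A : Set (ℕ → S)} (hA : MeasurableSet A) :
    pathLaw κ x A = ∫⁻ y, pathLaw κ y (consPath x ⁻¹' A) ∂(κ x) := by
  rw [← lintegral_indicator_one hA, lintegral_pathLaw κ x (measurable_one.indicator hA)]
  refine lintegral_congr fun y => ?_
  rw [← lintegral_indicator_one (measurable_consPath_right x hA)]
  rfl

theorem measurableSet_exists_lt_mem {K : Set S} (hK : MeasurableSet K) (n : ℕ) :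
    MeasurableSet {X : ℕ → S | ∃ k < n, X k ∈ K} := by
  have : {X : ℕ → S | ∃ k < n, X k ∈ K} = ⋃ k : ℕ, ⋃ _ : k < n, (fun X : ℕ → S => X k) ⁻¹' K := by
    ext X; simp
  rw [this]
  exact MeasurableSet.iUnion fun k => MeasurableSet.iUnion fun _ => measurable_pi_apply k hK

/-- First-entrance argument for `K`, by induction on the horizon. A step of the chain changes the
phase `ρ` to `ρ + 1`, which is why the bound on `K` is needed for all phases at once. -/
theorem pathLaw_avoiding_inter_le (m : ℕ) {C K : Set S} (hC : MeasurableSet C)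
    (hK : MeasurableSet K) {B : ℝ≥0∞} (hB : ∀ y ∈ K, ∀ ρ, pathLaw κ y (avoiding m C ρ) ≤ B)
    (n : ℕ) (x : S) (ρ : ℕ) :
    pathLaw κ x (avoiding m C ρ ∩ {X | ∃ k < n, X k ∈ K}) ≤ B := by
  induction n generalizing x ρ with
  | zero => simp
  | succ n ih =>
    by_cases hx : x ∈ K
    · exact (measure_mono Set.inter_subset_left).trans (hB x hx ρ)
    rw [pathLaw_apply κ x ((measurableSet_avoiding m hC ρ).inter
      (measurableSet_exists_lt_mem hK (n + 1)))]
    refine (lintegral_mono (g := fun _ => B) fun y => ?_).trans (by simp)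
    refine (measure_mono ?_).trans (ih y (ρ + 1))
    rintro ω ⟨h1, k, hk, h2⟩
    refine ⟨fun i hi => ?_, ?_⟩
    · exact h1 (i + 1) (by convert hi using 1; ring)
    · cases k with
      | zero => exact absurd h2 hx
      | succ k => exact ⟨k, by omega, h2⟩

theorem pathLaw_avoiding_le_of_recurrent (m : ℕ) {C K : Set S} (hC : MeasurableSet C)
    (hK : MeasurableSet K) {B : ℝ≥0∞} (hB : ∀ y ∈ K, ∀ ρ, pathLaw κ y (avoiding m C ρ) ≤ B)
    (hrec : ∀ x, ∀ᵐ X ∂(pathLaw κ x), ∃ n, X n ∈ K) (x : S) (ρ : ℕ) :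
    pathLaw κ x (avoiding m C ρ) ≤ B := by
  have hmono : Monotone fun n : ℕ => avoiding m C ρ ∩ {X : ℕ → S | ∃ k < n, X k ∈ K} := by
    intro a b hab
    refine Set.inter_subset_inter_right _ ?_
    rintro X ⟨k, hk, h⟩
    exact ⟨k, hk.trans_le hab, h⟩
  have : pathLaw κ x (avoiding m C ρ) =
      pathLaw κ x (⋃ n : ℕ, avoiding m C ρ ∩ {X : ℕ → S | ∃ k < n, X k ∈ K}) := by
    refine measure_congr ?_
    filter_upwards [hrec x] with X hX
    obtain ⟨n, hn⟩ := hX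
    refine propext ⟨fun h => Set.mem_iUnion.2 ⟨n + 1, h, n, n.lt_succ_self, hn⟩, fun h => ?_⟩
    obtain ⟨_, h, _⟩ := Set.mem_iUnion.1 h
    exact h
  rw [this, hmono.measure_iUnion]
  exact iSup_le fun n => pathLaw_avoiding_inter_le κ m hC hK hB n x ρ

/-- An avoiding path misses `C` at the admissible time `n`, which costs a factor `1 - η`, and by the
Markov property it goes on avoiding `C` in a shifted phase, which costs `M`. -/
theorem pathLaw_avoiding_le_mul (m : ℕ) {C : Set S} (hC : MeasurableSet C) {M η : ℝ≥0∞}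
    (hM : ∀ x ρ, pathLaw κ x (avoiding m C ρ) ≤ M) (y : S) {n ρ : ℕ} (hn : m ∣ n + ρ)
    (hη : η ≤ (κ ^ n) y C) : pathLaw κ y (avoiding m C ρ) ≤ (1 - η) * M := by
  have hA := measurableSet_avoiding m hC ρ
  have hA' := measurableSet_avoiding m hC (ρ + n)
  have hg : Measurable (Cᶜ.indicator (1 : S → ℝ≥0∞)) := measurable_one.indicator hC.compl
  rw [← lintegral_indicator_one hA,
    lintegral_pathLaw_splicePath κ n y (measurable_one.indicator hA)]
  calc _ ≤ ∫⁻ X, Cᶜ.indicator 1 (X n) * M ∂(pathLaw κ y) := by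
        refine lintegral_mono fun X => ?_
        calc _ ≤ ∫⁻ X', Cᶜ.indicator 1 (X' 0) * (avoiding m C (ρ + n)).indicator 1 X'
                ∂(pathLaw κ (X n)) := by
              refine lintegral_mono fun X' => ?_
              refine Set.indicator_apply_le' (fun h => ?_) (fun _ => zero_le)
              have h' : ∀ i, m ∣ n + i + ρ → X' i ∉ C := fun i hi => by
                have := h (n + i) hi
                simpa [splicePath] using this
              have h0 : X' 0 ∈ Cᶜ := h' 0 hn
              have h1 : X' ∈ avoiding m C (ρ + n) := fun i hi => h' i (by
                convert hi using 1; ring)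
              simp [h0, h1]
          _ = Cᶜ.indicator 1 (X n) * pathLaw κ (X n) (avoiding m C (ρ + n)) := by
              rw [lintegral_pathLaw_zero_mul κ (X n) hg (measurable_one.indicator hA'),
                lintegral_indicator_one hA']
          _ ≤ _ := by gcongr; exact hM _ _
    _ = (κ ^ n) y Cᶜ * M := by
        rw [lintegral_mul_const _ (by fun_prop), ← lintegral_pow_eq κ n y hg,
          lintegral_indicator_one hC.compl]
    _ ≤ (1 - η) * M := by
        have := isMarkovKernel_pow κ n
        rw [prob_compl_eq_one_sub hC]
        gcongr

/-- Chapman–Kolmogorov, keeping only the paths that are in `K` at time `n`; they have mass at least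
`ε * φ K`. -/
theorem Minorizes.add {κ : Kernel S S} {n n' : ℕ} {K : Set S} (hK : MeasurableSet K) {φ : Measure S}
    {ε ε' : ℝ} (hε : 0 < ε) (hε' : 0 < ε') [IsProbabilityMeasure φ] (h : Minorizes κ n K ε φ)
    (h' : Minorizes κ n' K ε' φ) :
    Minorizes κ (n + n') K (ε * ε' * (φ K).toReal) φ := by
  intro x hx B hB
  have hle : ENNReal.ofReal ε • φ ≤ (κ ^ n) x :=
    Measure.le_iff.2 fun A hA => by simpa using h x hx A hA
  rw [Kernel.pow_add_apply_eq_lintegral κ n n' x hB]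
  calc _ = ENNReal.ofReal ε * (φ K * (ENNReal.ofReal ε' * φ B)) := by
        rw [ENNReal.ofReal_mul (by positivity), ENNReal.ofReal_mul hε.le,
          ENNReal.ofReal_toReal (measure_ne_top _ _)]
        ring
    _ = ∫⁻ y, K.indicator (fun _ => ENNReal.ofReal ε' * φ B) y ∂(ENNReal.ofReal ε • φ) := by
        rw [lintegral_smul_measure, lintegral_indicator_const hK, smul_eq_mul]
        ring
    _ ≤ ∫⁻ y, K.indicator (fun _ => ENNReal.ofReal ε' * φ B) y ∂((κ ^ n) x) :=
        lintegral_mono' hle le_rfl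
    _ ≤ _ := lintegral_mono fun y => Set.indicator_le' (f := fun _ => ENNReal.ofReal ε' * φ B)
        (g := fun y => (κ ^ n') y B) (fun y hy => h' y hy B hB) (fun _ _ => zero_le) y

/-- The minorization times of the aperiodicity set `K` form an additive semigroup of gcd `1`, so
they include all large integers. Following a minorization by a fixed number `j` of steps that
carries `φ` into `C` gives a lower bound uniform on `K`, at some time in every residue class modulo
`m`. -/
theorem exists_uniform_hitting {κ : Kernel S S} [IsMarkovKernel κ] {π : Measure S}
    (hP : HarrisErgodic κ π) {C : Set S} (hC : MeasurableSet C) (hπC : 0 < π C) {m : ℕ}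
    (hm : 1 ≤ m) :
    ∃ K : Set S, MeasurableSet K ∧ 0 < π K ∧ ∃ η : ℝ≥0∞, 0 < η ∧
      ∀ ρ : ℕ, ∃ n, m ∣ n + ρ ∧ ∀ y ∈ K, η ≤ (κ ^ n) y C := by
  obtain ⟨K, φ, hK, hπK, hφ, hφK, hgcd⟩ := hP.aperiodic
  refine ⟨K, hK, hπK, ?_⟩
  set T : Set ℕ := {n | 1 ≤ n ∧ ∃ ε : ℝ, 0 < ε ∧ Minorizes κ n K ε φ} with hT
  have hTadd : ∀ a ∈ T, ∀ b ∈ T, a + b ∈ T := by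
    rintro a ⟨ha, ε, hε, h⟩ b ⟨_, ε', hε', h'⟩
    have : 0 < (φ K).toReal := ENNReal.toReal_pos hφK.ne' (measure_ne_top _ _)
    exact ⟨by omega, _, by positivity, Minorizes.add hK hε hε' h h'⟩
  have h1 : Nat.setGcd T = 1 := hgcd _ fun n hn hn' => Nat.setGcd_dvd_of_mem ⟨hn, hn'⟩
  obtain ⟨N, hN⟩ := Nat.exists_mem_closure_of_ge T
  have hNT : ∀ n, N ≤ n → 1 ≤ n → n ∈ T := by
    intro n hn hn1
    -- The additive closure also contains `0`, which `T` does not.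
    have : n = 0 ∨ n ∈ T := by
      refine AddSubmonoid.closure_induction (motive := fun n _ => n = 0 ∨ n ∈ T)
        (fun n hn => Or.inr hn) (Or.inl rfl) ?_ (hN n hn (by simp [h1]))
      rintro a b _ _ (rfl | ha) (rfl | hb)
      · exact Or.inl rfl
      · exact Or.inr (by simpa using hb)
      · exact Or.inr (by simpa using ha)
      · exact Or.inr (hTadd a ha b hb)
    exact this.resolve_left (by omega)
  -- Otherwise some starting point almost surely never reaches `C`, against Harris recurrence.
  obtain ⟨j, hj⟩ : ∃ j, ∫⁻ z, (κ ^ j) z C ∂φ ≠ 0 := by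
    by_contra! hcon
    have h2 : ∀ᵐ z ∂φ, ∀ j, (κ ^ j) z C = 0 := by
      rw [ae_all_iff]
      intro j
      exact (lintegral_eq_zero_iff (Kernel.measurable_coe (κ ^ j) hC)).1 (hcon j)
    obtain ⟨z, hz⟩ := h2.exists
    have h3 : ∀ᵐ X ∂(pathLaw κ z), ∀ j, X j ∉ C := by
      rw [ae_all_iff]
      intro j
      have e := lintegral_pow_eq κ j z (measurable_one.indicator hC)
      rw [lintegral_indicator_one hC, hz j] at e
      have := (lintegral_eq_zero_iff
        ((measurable_one.indicator hC).comp (measurable_pi_apply j))).1 e.symm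
      filter_upwards [this] with X hX hXC
      simp [hXC] at hX
    obtain ⟨X, hX, hX'⟩ := (h3.and (hP.harrisRecurrent C hC hπC z)).exists
    obtain ⟨n, hn⟩ := hX'.exists
    exact hX n hn
  have hpos : ∀ n ∈ T, ∃ η : ℝ≥0∞, 0 < η ∧ ∀ y ∈ K, η ≤ (κ ^ (n + j)) y C := by
    rintro n ⟨_, ε, hε, h⟩
    refine ⟨ENNReal.ofReal ε * ∫⁻ z, (κ ^ j) z C ∂φ,
      ENNReal.mul_pos (by simpa using hε) hj, fun y hy => ?_⟩
    have hle : ENNReal.ofReal ε • φ ≤ (κ ^ n) y :=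
      Measure.le_iff.2 fun A hA => by simpa using h y hy A hA
    rw [Kernel.pow_add_apply_eq_lintegral κ n j y hC, ← smul_eq_mul, ← lintegral_smul_measure]
    exact lintegral_mono' hle le_rfl
  have hres : ∀ ρ : ℕ, ∃ η : ℝ≥0∞, 0 < η ∧ ∃ n, m ∣ n + ρ ∧ ∀ y ∈ K, η ≤ (κ ^ n) y C := by
    intro ρ
    have hge : N + 1 + j + ρ ≤ m * (N + 1 + j + ρ) := Nat.le_mul_of_pos_left _ hm
    obtain ⟨η, hη, h⟩ := hpos (m * (N + 1 + j + ρ) - j - ρ) (hNT _ (by omega) (by omega))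
    exact ⟨η, hη, _, ⟨N + 1 + j + ρ, by omega⟩, h⟩
  choose η hη hη' using hres
  -- Only `ρ` modulo `m` matters, so a minimum over finitely many phases is a common positive bound.
  refine ⟨(Finset.range m).inf η, ?_, fun ρ => ?_⟩
  · rw [Finset.lt_inf_iff (by simp)]
    exact fun ρ _ => hη ρ
  · obtain ⟨n, hn, h⟩ := hη' (ρ % m)
    refine ⟨n, ?_, fun y hy =>
      (Finset.inf_le (Finset.mem_range.2 (Nat.mod_lt ρ hm))).trans (h y hy)⟩
    have := Nat.mod_add_div ρ m
    rw [← this, ← add_assoc]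
    exact dvd_add hn (dvd_mul_right _ _)

/-- The `m`-skeleton of a Harris ergodic chain visits every set of positive stationary measure. -/
theorem HarrisErgodic.pathLaw_avoiding_eq_zero {κ : Kernel S S} [IsMarkovKernel κ] {π : Measure S}
    (hP : HarrisErgodic κ π) {C : Set S} (hC : MeasurableSet C) (hπC : 0 < π C) {m : ℕ}
    (hm : 1 ≤ m) (x : S) (ρ : ℕ) : pathLaw κ x (avoiding m C ρ) = 0 := by
  obtain ⟨K, hK, hπK, η, hη, hunif⟩ := exists_uniform_hitting hP hC hπC hm
  -- The supremum over all starting points and phases satisfies `M ≤ (1 - η) * M`: every path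
  -- reaches `K`, and from `K` the loss `η` is incurred.
  set M : ℝ≥0∞ := ⨆ x, ⨆ ρ, pathLaw κ x (avoiding m C ρ) with hMdef
  have hle : ∀ x ρ, pathLaw κ x (avoiding m C ρ) ≤ M := fun x ρ =>
    le_iSup_of_le x (le_iSup_of_le ρ le_rfl)
  have hM1 : M ≤ 1 := iSup_le fun x => iSup_le fun ρ => prob_le_one
  have hKle : ∀ y ∈ K, ∀ ρ, pathLaw κ y (avoiding m C ρ) ≤ (1 - η) * M := by
    intro y hy ρ
    obtain ⟨n, hn, h⟩ := hunif ρ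
    exact pathLaw_avoiding_le_mul κ m hC hle y hn (h y hy)
  have hrec : ∀ x, ∀ᵐ X ∂(pathLaw κ x), ∃ n, X n ∈ K := fun x =>
    (hP.harrisRecurrent K hK hπK x).mono fun X hX => hX.exists
  have hMM : M ≤ (1 - η) * M := iSup_le fun x => iSup_le fun ρ =>
    pathLaw_avoiding_le_of_recurrent κ m hC hK hKle hrec x ρ
  have h0 : M = 0 := eq_zero_of_le_mul
    (ENNReal.sub_lt_self ENNReal.one_ne_top one_ne_zero hη.ne')
    (hM1.trans_lt ENNReal.one_lt_top).ne hMM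
  exact le_antisymm ((hle x ρ).trans h0.le) (zero_le)

end Recurrence

/-! ### Truncated functionals of paths up to hitting and regeneration. -/

section Functionals

variable {S : Type*} {m : ℕ}

open Classical in
/-- `φ (s + ∑_{i < T} z (block i))`, where `T` is the first visit of the `m`-skeleton to `C`, if
`T < n`, and `0` otherwise. -/
def hitFun (C : Set S) (z : (Fin (m + 1) → S) → ℝ) (φ : ℝ → ℝ≥0∞) : ℕ → ℝ → (ℕ → S) → ℝ≥0∞
  | 0, _, _ => 0
  | n + 1, s, X => if X 0 ∈ C then φ s else
      hitFun C z φ n (s + z (initBlock m X)) (shiftPath m X)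

/-- `φ (s + ∑_{i ≤ σ} z (block i))`, where `σ` is the first regeneration time, if `σ < n`, and `0`
otherwise. -/
def regFun (z : (Fin (m + 1) → S) → ℝ) (φ : ℝ → ℝ≥0∞) :
    ℕ → ℝ → (ℕ → Bool × (Fin (m + 1) → S)) → ℝ≥0∞
  | 0, _, _ => 0
  | n + 1, s, e => if (e 0).1 = true then φ (s + z (e 0).2) else
      regFun z φ n (s + z (e 0).2) (shiftPath 1 e)

/-- `φ` of the sum of `z` over the `i`-th excursion between regeneration times, if this excursion
ends before time `n`, and `0` otherwise. -/
def excFun (z : (Fin (m + 1) → S) → ℝ) (φ : ℝ → ℝ≥0∞) :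
    ℕ → ℕ → (ℕ → Bool × (Fin (m + 1) → S)) → ℝ≥0∞
  | 0, _, _ => 0
  | n + 1, 0, e => if (e 0).1 = true then regFun z φ n 0 (shiftPath 1 e) else
      excFun z φ n 0 (shiftPath 1 e)
  | n + 1, i + 1, e => if (e 0).1 = true then excFun z φ n i (shiftPath 1 e) else
      excFun z φ n (i + 1) (shiftPath 1 e)

theorem hitFun_eq_zero_or (C : Set S) (z : (Fin (m + 1) → S) → ℝ) (φ : ℝ → ℝ≥0∞) (n : ℕ) (s : ℝ)
    (X : ℕ → S) :
    hitFun C z φ n s X = 0 ∨ ∃ T, X (T * m) ∈ C ∧ (∀ k < T, X (k * m) ∉ C) ∧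
      hitFun C z φ n s X =
        φ (s + ∑ i ∈ Finset.range T, z (initBlock m (shiftPath (i * m) X))) := by
  induction n generalizing s X with
  | zero => exact Or.inl rfl
  | succ n ih =>
    by_cases h : X 0 ∈ C
    · exact Or.inr ⟨0, by simpa using h, by simp, by simp [hitFun, h]⟩
    · rcases ih (s + z (initBlock m X)) (shiftPath m X) with h0 | ⟨T, h1, h2, h3⟩
      · exact Or.inl (by simp [hitFun, h, h0])
      · have e : ∀ i, shiftPath (i * m) (shiftPath m X) = shiftPath ((i + 1) * m) X := by
          intro i; funext j; simp only [shiftPath_apply]; congr 1; ring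
        refine Or.inr ⟨T + 1, ?_, ?_, ?_⟩
        · convert h1 using 1; simp only [shiftPath_apply]; congr 1; ring
        · intro k hk
          cases k with
          | zero => simpa using h
          | succ k =>
            have := h2 k (by omega)
            convert this using 2; simp only [shiftPath_apply]; congr 1; ring
        · simp only [hitFun, h, if_false, h3, e]
          rw [Finset.sum_range_succ']
          have e0 : shiftPath (0 * m) X = X := by funext j; simp
          rw [e0]; congr 1; ring

theorem hitFun_rpow (C : Set S) (z : (Fin (m + 1) → S) → ℝ) (φ : ℝ → ℝ≥0∞) {t : ℝ} (ht : 0 < t)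
    (n : ℕ) (s : ℝ) (X : ℕ → S) :
    hitFun C z φ n s X ^ t = hitFun C z (fun u => φ u ^ t) n s X := by
  induction n generalizing s X with
  | zero => simp [hitFun, ht]
  | succ n ih =>
    by_cases h : X 0 ∈ C
    · simp [hitFun, h]
    · simp [hitFun, h, ih]

theorem regFun_eq (z : (Fin (m + 1) → S) → ℝ) (φ : ℝ → ℝ≥0∞) (T : ℕ) (s : ℝ)
    (e : ℕ → Bool × (Fin (m + 1) → S)) (hT : (e T).1 = true) (hlt : ∀ k < T, ¬ (e k).1 = true)
    (n : ℕ) (hn : T < n) :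
    regFun z φ n s e = φ (s + ∑ i ∈ Finset.range (T + 1), z (e i).2) := by
  induction T generalizing s e n with
  | zero =>
    obtain ⟨n, rfl⟩ := Nat.exists_eq_succ_of_ne_zero hn.ne'
    simp [regFun, hT]
  | succ T ih =>
    obtain ⟨n, rfl⟩ := Nat.exists_eq_succ_of_ne_zero (Nat.zero_lt_of_lt hn).ne'
    have h0 := hlt 0 T.succ_pos
    rw [Nat.succ_eq_add_one, regFun, if_neg h0, ih _ (shiftPath 1 e)
      (by simpa [Nat.add_comm 1 T] using hT)
      (fun k hk => by simpa [Nat.add_comm 1 k] using hlt (k + 1) (by omega)) n (by omega),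
      Finset.sum_range_succ' _ (T + 1)]
    simp only [shiftPath_apply, Nat.add_comm 1]
    congr 1; ring

theorem infinite_setOf_succ {p : ℕ → Prop} (hp : {k | p k}.Infinite) :
    {k | p (k + 1)}.Infinite := by
  rw [← Nat.frequently_atTop_iff_infinite] at hp ⊢
  rw [Filter.frequently_atTop] at hp ⊢
  intro a
  obtain ⟨b, hb, hpb⟩ := hp (a + 1)
  obtain ⟨b, rfl⟩ := Nat.exists_eq_succ_of_ne_zero (show b ≠ 0 by omega)
  exact ⟨b, by omega, hpb⟩

/-- A point where `p` holds is the `nth` one indexed by its own count, and the count over the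
shifted predicate differs from it by the contribution of `0` alone. -/
theorem nth_succ_of_true {p : ℕ → Prop} (hp : {k | p k}.Infinite) (h0 : p 0) (i : ℕ) :
    Nat.nth p (i + 1) = Nat.nth (fun k => p (k + 1)) i + 1 := by
  classical
  have hinf := infinite_setOf_succ hp
  have h1 : p (Nat.nth (fun k => p (k + 1)) i + 1) :=
    Nat.nth_mem_of_infinite (p := fun k => p (k + 1)) hinf i
  have h2 := Nat.nth_count h1
  rw [Nat.count_succ', Nat.count_nth_of_infinite (p := fun k => p (k + 1)) hinf i] at h2
  simpa [h0] using h2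

theorem nth_of_not {p : ℕ → Prop} (hp : {k | p k}.Infinite) (h0 : ¬ p 0) (i : ℕ) :
    Nat.nth p i = Nat.nth (fun k => p (k + 1)) i + 1 := by
  classical
  have hinf := infinite_setOf_succ hp
  have h1 : p (Nat.nth (fun k => p (k + 1)) i + 1) :=
    Nat.nth_mem_of_infinite (p := fun k => p (k + 1)) hinf i
  have h2 := Nat.nth_count h1
  rw [Nat.count_succ', Nat.count_nth_of_infinite (p := fun k => p (k + 1)) hinf i] at h2
  simpa [h0] using h2

theorem sigma_zero_spec {e : ℕ → Bool × (Fin (m + 1) → S)} (h : ∃ k, (e k).1 = true) :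
    (e (sigma e 0)).1 = true ∧ ∀ k < sigma e 0, ¬ (e k).1 = true := by
  classical
  rw [sigma, Nat.nth_zero_of_exists h]
  exact ⟨Nat.find_spec h, fun k hk => Nat.find_min h hk⟩

theorem infinite_shiftPath {e : ℕ → Bool × (Fin (m + 1) → S)}
    (h : {k | (e k).1 = true}.Infinite) : {k | (shiftPath 1 e k).1 = true}.Infinite := by
  simpa [Nat.add_comm 1] using infinite_setOf_succ h

theorem sigma_shiftPath_of_true {e : ℕ → Bool × (Fin (m + 1) → S)}
    (h : {k | (e k).1 = true}.Infinite) (h0 : (e 0).1 = true) (i : ℕ) :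
    sigma e (i + 1) = sigma (shiftPath 1 e) i + 1 := by
  rw [sigma, nth_succ_of_true h h0 i]
  simp [sigma, Nat.add_comm 1]

theorem sigma_shiftPath_of_not {e : ℕ → Bool × (Fin (m + 1) → S)}
    (h : {k | (e k).1 = true}.Infinite) (h0 : ¬ (e 0).1 = true) (i : ℕ) :
    sigma e i = sigma (shiftPath 1 e) i + 1 := by
  rw [sigma, nth_of_not h h0 i]
  simp [sigma, Nat.add_comm 1]

theorem sum_Ioc_succ_shiftPath (z : (Fin (m + 1) → S) → ℝ) (e : ℕ → Bool × (Fin (m + 1) → S))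
    (a b : ℕ) :
    ∑ j ∈ Finset.Ioc (a + 1) (b + 1), z (e j).2 =
      ∑ j ∈ Finset.Ioc a b, z (shiftPath 1 e j).2 := by
  rw [← Finset.map_add_right_Ioc a b 1, Finset.sum_map]
  simp [Nat.add_comm 1]

/-- Nested induction on `i` and on the position `T` of the first regeneration. Each step removes the
first block, which lowers `T`, or lowers `i` when that block regenerates. -/
theorem excFun_eventually_eq (z : (Fin (m + 1) → S) → ℝ) (φ : ℝ → ℝ≥0∞) (i : ℕ)
    (e : ℕ → Bool × (Fin (m + 1) → S)) (h : {k | (e k).1 = true}.Infinite) :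
    ∀ᶠ n in Filter.atTop, excFun z φ n i e =
      φ (∑ j ∈ Finset.Ioc (sigma e i) (sigma e (i + 1)), z (e j).2) := by
  have hnot : ∀ (i : ℕ) (e : ℕ → Bool × (Fin (m + 1) → S)), {k | (e k).1 = true}.Infinite →
      ¬ (e 0).1 = true → (∀ᶠ n in Filter.atTop, excFun z φ n i (shiftPath 1 e) =
        φ (∑ j ∈ Finset.Ioc (sigma (shiftPath 1 e) i) (sigma (shiftPath 1 e) (i + 1)),
          z (shiftPath 1 e j).2)) →
      ∀ᶠ n in Filter.atTop, excFun z φ n i e =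
        φ (∑ j ∈ Finset.Ioc (sigma e i) (sigma e (i + 1)), z (e j).2) := by
    intro i e h h0 hev
    rw [← Filter.map_add_atTop_eq_nat 1, Filter.eventually_map]
    filter_upwards [hev] with n hn
    rw [sigma_shiftPath_of_not h h0, sigma_shiftPath_of_not h h0, sum_Ioc_succ_shiftPath, ← hn]
    cases i <;> rw [excFun, if_neg h0]
  obtain ⟨hT, hlt⟩ := sigma_zero_spec h.nonempty
  generalize sigma e 0 = T at hT hlt
  induction i generalizing e T with
  | zero =>
    induction T generalizing e with
    | zero =>
      have hs := infinite_shiftPath h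
      obtain ⟨h1, h2⟩ := sigma_zero_spec (e := shiftPath 1 e) hs.nonempty
      rw [← Filter.map_add_atTop_eq_nat 1, Filter.eventually_map]
      filter_upwards [Filter.eventually_gt_atTop (sigma (shiftPath 1 e) 0)] with n hn
      -- The regeneration block itself is not in the sum, so the excursion is the initial stretch of
      -- the shifted sequence up to and including its first regeneration block.
      have hσ : sigma e 0 = 0 := Nat.nth_zero_of_zero hT
      rw [excFun, if_pos hT, regFun_eq z φ _ 0 _ h1 h2 n hn, sigma_shiftPath_of_true h hT, hσ,
        zero_add, Finset.range_eq_Ico, ← Finset.Ico_add_one_add_one_eq_Ioc,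
        ← Finset.map_add_right_Ico 0 _ 1, Finset.sum_map]
      simp [Nat.add_comm 1]
    | succ T ih =>
      exact hnot 0 e h (hlt 0 T.succ_pos) (ih (shiftPath 1 e) (infinite_shiftPath h)
        (by simpa [Nat.add_comm 1] using hT)
        fun k hk => by simpa [Nat.add_comm 1] using hlt (k + 1) (by omega))
  | succ i ih =>
    induction T generalizing e with
    | zero =>
      have hs := infinite_shiftPath h
      obtain ⟨h1, h2⟩ := sigma_zero_spec (e := shiftPath 1 e) hs.nonempty
      rw [← Filter.map_add_atTop_eq_nat 1, Filter.eventually_map]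
      filter_upwards [ih (shiftPath 1 e) hs _ h1 h2] with n hn
      rw [excFun, if_pos hT, sigma_shiftPath_of_true h hT, sigma_shiftPath_of_true h hT,
        sum_Ioc_succ_shiftPath, hn]
    | succ T ihT =>
      exact hnot (i + 1) e h (hlt 0 T.succ_pos) (ihT (shiftPath 1 e) (infinite_shiftPath h)
        (by simpa [Nat.add_comm 1] using hT)
        fun k hk => by simpa [Nat.add_comm 1] using hlt (k + 1) (by omega))

section Measurability

variable [MeasurableSpace S] {z : (Fin (m + 1) → S) → ℝ} {φ : ℝ → ℝ≥0∞}

theorem measurable_hitFun {C : Set S} (hC : MeasurableSet C) (hz : Measurable z)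
    (hφ : Measurable φ) (n : ℕ) :
    Measurable fun p : ℝ × (ℕ → S) => hitFun C z φ n p.1 p.2 := by
  induction n with
  | zero => exact measurable_const
  | succ n ih =>
    simp only [hitFun]
    refine Measurable.ite (((measurable_pi_apply 0).comp measurable_snd) hC)
      (hφ.comp measurable_fst) ?_
    exact ih.comp (f := fun p : ℝ × (ℕ → S) => (p.1 + z (initBlock m p.2), shiftPath m p.2))
      (by fun_prop)

theorem measurable_regFun (hz : Measurable z) (hφ : Measurable φ) (n : ℕ) :
    Measurable fun p : ℝ × (ℕ → Bool × (Fin (m + 1) → S)) => regFun z φ n p.1 p.2 := by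
  induction n with
  | zero => exact measurable_const
  | succ n ih =>
    simp only [regFun]
    refine Measurable.ite ?_ (by fun_prop) ?_
    · exact (measurable_fst.comp ((measurable_pi_apply 0).comp measurable_snd))
        (measurableSet_singleton true)
    · exact ih.comp (f := fun p : ℝ × (ℕ → Bool × (Fin (m + 1) → S)) =>
        (p.1 + z (p.2 0).2, shiftPath 1 p.2)) (by fun_prop)

theorem measurable_excFun (hz : Measurable z) (hφ : Measurable φ) (n i : ℕ) :
    Measurable (excFun z φ n i) := by
  induction n generalizing i with
  | zero => exact measurable_const
  | succ n ih =>
    have hm : MeasurableSet {e : ℕ → Bool × (Fin (m + 1) → S) | (e 0).1 = true} :=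
      (measurable_fst.comp (measurable_pi_apply 0)) (measurableSet_singleton true)
    have hr : Measurable fun e : ℕ → Bool × (Fin (m + 1) → S) =>
        regFun z φ n 0 (shiftPath 1 e) :=
      (measurable_regFun hz hφ n).comp (f := fun e => ((0 : ℝ), shiftPath 1 e)) (by fun_prop)
    cases i with
    | zero => exact Measurable.ite hm hr ((ih 0).comp (measurable_shiftPath 1))
    | succ i =>
      exact Measurable.ite hm ((ih i).comp (measurable_shiftPath 1))
        ((ih (i + 1)).comp (measurable_shiftPath 1))

end Measurability

end Functionals

/-! ### Recursive estimates for the split chain. -/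

section Estimates

variable {S : Type*} [MeasurableSpace S] (κ : Kernel S S) [IsMarkovKernel κ] {m : ℕ} {C : Set S}
  {z : (Fin (m + 1) → S) → ℝ} {φ : ℝ → ℝ≥0∞}

theorem lintegral_hitFun_of_mem (hC : MeasurableSet C) {x : S} (hx : x ∈ C) (n : ℕ) (s : ℝ) :
    ∫⁻ X, hitFun C z φ (n + 1) s X ∂(pathLaw κ x) = φ s := by
  have : ∀ᵐ X ∂(pathLaw κ x), hitFun C z φ (n + 1) s X = φ s := by
    filter_upwards [ae_pathLaw_zero κ x (p := (· ∈ C)) hC hx] with X hX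
    simp [hitFun, hX]
  rw [lintegral_congr_ae this]
  simp

theorem lintegral_hitFun_of_notMem (hC : MeasurableSet C) (hz : Measurable z) (hφ : Measurable φ)
    {x : S} (hx : x ∉ C) (n : ℕ) (s : ℝ) :
    ∫⁻ X, hitFun C z φ (n + 1) s X ∂(pathLaw κ x) =
      ∫⁻ w, ∫⁻ X, hitFun C z φ n (s + z w) X ∂(pathLaw κ (w (Fin.last m))) ∂(blockLaw κ m x) := by
  have h : ∀ᵐ X ∂(pathLaw κ x), hitFun C z φ (n + 1) s X =
      hitFun C z φ n (s + z (initBlock m X)) (shiftPath m X) := by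
    filter_upwards [ae_pathLaw_zero κ x (p := (· ∉ C)) hC.compl hx] with X hX
    simp [hitFun, hX]
  rw [lintegral_congr_ae h]
  refine lintegral_pathLaw_block κ m x (F := fun w X => hitFun C z φ n (s + z w) X) ?_
  exact (measurable_hitFun hC hz hφ n).comp
    (f := fun p : (Fin (m + 1) → S) × (ℕ → S) => (s + z p.1, p.2)) (by fun_prop)

theorem measurable_lintegral_hitFun (hC : MeasurableSet C) (hz : Measurable z)
    (hφ : Measurable φ) (n : ℕ) (s : ℝ) :
    Measurable fun w : Fin (m + 1) → S =>
      ∫⁻ X, hitFun C z φ n s X ∂(pathLaw κ (w (Fin.last m))) := by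
  have h : Measurable fun X => hitFun C z φ n s X :=
    (measurable_hitFun hC hz hφ n).comp (f := fun X : ℕ → S => (s, X)) (by fun_prop)
  exact h.lintegral_kernel.comp (measurable_pi_apply (Fin.last m))

theorem measurable_regFun_right (hz : Measurable z) (hφ : Measurable φ) (n : ℕ) (s : ℝ) :
    Measurable fun e => regFun z φ n s e :=
  (measurable_regFun hz hφ n).comp
    (f := fun e : ℕ → Bool × (Fin (m + 1) → S) => (s, e)) (by fun_prop)

variable [MeasurableSpace.CountablyGenerated S] (δ : ℝ) (ν : Measure S)

theorem measurable_splitDensity_last (hC : MeasurableSet C) (x : S) :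
    Measurable fun w : Fin (m + 1) → S => splitDensity κ m C δ ν x (w (Fin.last m)) :=
  (measurable_splitDensity κ m hC δ ν).comp measurable_prodMk_left

theorem lintegral_splitKernel_block (hC : MeasurableSet C) (x : S)
    {F : (ℕ → Bool × (Fin (m + 1) → S)) → ℝ≥0∞} (hF : Measurable F) :
    ∫⁻ e, F e ∂(splitKernel κ m δ ν hC x) =
      ∫⁻ w, (splitDensity κ m C δ ν x (w (Fin.last m)) *
          ∫⁻ e, F (consPath (true, w) e) ∂(splitKernel κ m δ ν hC (w (Fin.last m))) +
        (1 - splitDensity κ m C δ ν x (w (Fin.last m))) *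
          ∫⁻ e, F (consPath (false, w) e) ∂(splitKernel κ m δ ν hC (w (Fin.last m))))
        ∂(blockLaw κ m x) := by
  rw [lintegral_splitKernel κ m δ ν hC x hF,
    lintegral_splitBlock κ m δ ν hC x (measurable_lintegral_consPath κ m δ ν hC hF)]

theorem lintegral_regFun_succ (hC : MeasurableSet C) (hz : Measurable z) (hφ : Measurable φ)
    (x : S) (n : ℕ) (s : ℝ) :
    ∫⁻ e, regFun z φ (n + 1) s e ∂(splitKernel κ m δ ν hC x) =
      ∫⁻ w, (splitDensity κ m C δ ν x (w (Fin.last m)) * φ (s + z w) +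
        (1 - splitDensity κ m C δ ν x (w (Fin.last m))) *
          ∫⁻ e, regFun z φ n (s + z w) e ∂(splitKernel κ m δ ν hC (w (Fin.last m))))
        ∂(blockLaw κ m x) := by
  have := isMarkovKernel_splitKernel κ m δ ν hC
  rw [lintegral_splitKernel_block κ δ ν hC x (measurable_regFun_right hz hφ (n + 1) s)]
  simp [regFun]

variable {δ ν} in
/-- The exponential functional of the path up to the first regeneration is dominated by that of
the path up to the first visit to `C`. -/
theorem lintegral_regFun_le (hC : MeasurableSet C) (hz : Measurable z) (hφ : Measurable φ)
    (hsub : ∀ a b, φ (a + b) ≤ φ a * φ b) {p q g : ℝ≥0∞} (hg : p + q * g ≤ g)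
    (hp : ∀ x ∈ C, ∫⁻ w, splitDensity κ m C δ ν x (w (Fin.last m)) * φ (z w)
      ∂(blockLaw κ m x) ≤ p)
    (hq : ∀ x ∈ C, ∀ n, ∫⁻ w, (1 - splitDensity κ m C δ ν x (w (Fin.last m))) * (φ (z w) *
      ∫⁻ X, hitFun C z φ n 0 X ∂(pathLaw κ (w (Fin.last m)))) ∂(blockLaw κ m x) ≤ q)
    (n : ℕ) (x : S) (b s : ℝ) :
    ∫⁻ e, regFun z φ n (b + s) e ∂(splitKernel κ m δ ν hC x) ≤
      φ b * g * ∫⁻ X, hitFun C z φ n s X ∂(pathLaw κ x) := by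
  induction n generalizing x b s with
  | zero => simp [regFun]
  | succ n ih =>
    rw [lintegral_regFun_succ κ δ ν hC hz hφ]
    have hDm := measurable_splitDensity_last (m := m) κ δ ν hC x
    by_cases hx : x ∈ C
    · rw [lintegral_hitFun_of_mem κ hC hx]
      have hRm := measurable_lintegral_hitFun κ hC hz hφ n 0
      have hφz : Measurable fun w : Fin (m + 1) → S => φ (z w) := hφ.comp hz
      calc _ ≤ ∫⁻ w, (φ b * φ s * (splitDensity κ m C δ ν x (w (Fin.last m)) * φ (z w)) +
            φ b * φ s * g * ((1 - splitDensity κ m C δ ν x (w (Fin.last m))) * (φ (z w) *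
              ∫⁻ X, hitFun C z φ n 0 X ∂(pathLaw κ (w (Fin.last m)))))) ∂(blockLaw κ m x) := by
            refine lintegral_mono fun w => ?_
            -- Submultiplicativity is spent only at visits to `C`. Between visits the sum stays in
            -- `s` inside the hitting functional, so that signed cancellations within an excursion
            -- are kept.
            have h1 : φ (b + s + z w) ≤ φ b * φ s * φ (z w) :=
              (hsub _ _).trans (by gcongr; exact hsub _ _)
            -- After a block that does not regenerate, everything accumulated moves into the factor
            -- `φ b`, and a fresh excursion starts from `0`.
            have h2 := ih (w (Fin.last m)) (b + s + z w) 0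
            rw [add_zero] at h2
            refine add_le_add ?_ ?_
            · calc _ ≤ splitDensity κ m C δ ν x (w (Fin.last m)) * (φ b * φ s * φ (z w)) := by
                    gcongr
                _ = _ := by ring
            · calc _ ≤ (1 - splitDensity κ m C δ ν x (w (Fin.last m))) *
                    (φ b * φ s * φ (z w) * g *
                      ∫⁻ X, hitFun C z φ n 0 X ∂(pathLaw κ (w (Fin.last m)))) := by
                    gcongr
                    exact h2.trans (by gcongr)
                _ = _ := by ring
        _ = φ b * φ s * ∫⁻ w, splitDensity κ m C δ ν x (w (Fin.last m)) * φ (z w)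
              ∂(blockLaw κ m x) + φ b * φ s * g * ∫⁻ w,
              (1 - splitDensity κ m C δ ν x (w (Fin.last m))) * (φ (z w) *
              ∫⁻ X, hitFun C z φ n 0 X ∂(pathLaw κ (w (Fin.last m)))) ∂(blockLaw κ m x) := by
            rw [lintegral_add_left (by fun_prop), lintegral_const_mul _ (by fun_prop),
              lintegral_const_mul _ (by fun_prop)]
        _ ≤ φ b * φ s * p + φ b * φ s * g * q := by
            gcongr
            · exact hp x hx
            · exact hq x hx n
        _ = φ b * φ s * (p + q * g) := by ring
        _ ≤ φ b * φ s * g := by gcongr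
        _ = _ := by ring
    · rw [lintegral_hitFun_of_notMem κ hC hz hφ hx, ← lintegral_const_mul]
      · refine lintegral_mono fun w => ?_
        simp only [splitDensity_of_notMem κ m δ ν hx, zero_mul, zero_add, tsub_zero, one_mul]
        rw [add_assoc]
        exact ih _ _ _
      · have h : Measurable (Function.uncurry fun (w : Fin (m + 1) → S) (X : ℕ → S) =>
            hitFun C z φ n (s + z w) X) := (measurable_hitFun hC hz hφ n).comp
              (f := fun p : (Fin (m + 1) → S) × (ℕ → S) => (s + z p.1, p.2)) (by fun_prop)
        exact h.lintegral_kernel_prod_right' (κ := (pathLaw κ).comap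
          (fun w : Fin (m + 1) → S => w (Fin.last m)) (measurable_pi_apply _))

variable {δ ν} in
-- A bound per unit of regeneration mass, uniform in the starting point, gives the same bound for
-- every excursion and every initial point. A block contributes `B` times its regeneration mass,
-- plus `B` times the remaining mass by induction, and these masses add up to `1`.
theorem lintegral_excFun_le (hC : MeasurableSet C) (hz : Measurable z) (hφ : Measurable φ)
    {B : ℝ≥0∞}
    (hreg : ∀ x n, ∫⁻ w, splitDensity κ m C δ ν x (w (Fin.last m)) *
      ∫⁻ e, regFun z φ n 0 e ∂(splitKernel κ m δ ν hC (w (Fin.last m))) ∂(blockLaw κ m x) ≤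
      B * ∫⁻ w, splitDensity κ m C δ ν x (w (Fin.last m)) ∂(blockLaw κ m x))
    (n i : ℕ) (x : S) : ∫⁻ e, excFun z φ n i e ∂(splitKernel κ m δ ν hC x) ≤ B := by
  have := isMarkovKernel_splitKernel κ m δ ν hC
  induction n generalizing i x with
  | zero => simp [excFun]
  | succ n ih =>
    have hDm := measurable_splitDensity_last (m := m) κ δ ν hC x
    have htot : B * ∫⁻ w, splitDensity κ m C δ ν x (w (Fin.last m)) ∂(blockLaw κ m x) +
        ∫⁻ w, (1 - splitDensity κ m C δ ν x (w (Fin.last m))) * B ∂(blockLaw κ m x) = B := by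
      rw [← lintegral_const_mul _ hDm, ← lintegral_add_left (by fun_prop)]
      have : ∀ w : Fin (m + 1) → S, B * splitDensity κ m C δ ν x (w (Fin.last m)) +
          (1 - splitDensity κ m C δ ν x (w (Fin.last m))) * B = B := fun w => by
        rw [mul_comm B, ← add_mul, add_tsub_cancel_of_le (splitDensity_le_one κ m δ ν x _), one_mul]
      simp [this]
    rw [lintegral_splitKernel_block κ δ ν hC x (measurable_excFun hz hφ (n + 1) i)]
    cases i with
    | zero =>
      have hm : Measurable fun w : Fin (m + 1) → S =>
          ∫⁻ e, regFun z φ n 0 e ∂(splitKernel κ m δ ν hC (w (Fin.last m))) :=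
        (measurable_regFun_right hz hφ n 0).lintegral_kernel.comp (measurable_pi_apply (Fin.last m))
      simp only [excFun, consPath_zero, shiftPath_one_consPath, if_true, Bool.false_eq_true,
        if_false]
      rw [lintegral_add_left (by fun_prop)]
      refine (add_le_add (hreg x n) ?_).trans htot.le
      exact lintegral_mono fun w => by gcongr; exact ih 0 _
    | succ i =>
      simp only [excFun, consPath_zero, shiftPath_one_consPath, if_true, Bool.false_eq_true,
        if_false]
      refine le_trans ?_ htot.le
      rw [← lintegral_const_mul _ hDm, ← lintegral_add_left (by fun_prop)]
      refine lintegral_mono fun w => add_le_add ?_ ?_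
      · rw [mul_comm B]; gcongr; exact ih i _
      · gcongr; exact ih (i + 1) _

/-! ### Infinitely many regenerations. -/

section Regeneration

variable {δ ν}

/-- The split chain never regenerates with probability `0`. -/
theorem splitKernel_forall_not_eq_zero [IsProbabilityMeasure ν] (hC : MeasurableSet C)
    (hδ : 0 < δ) (hmin : Minorizes κ m C δ ν)
    (hrec : ∀ x, pathLaw κ x (avoiding m C 0) = 0) (x : S) :
    splitKernel κ m δ ν hC x {e | ∀ k, (e k).1 = false} = 0 := by
  have hMk := isMarkovKernel_splitKernel κ m δ ν hC
  set A : Set (ℕ → Bool × (Fin (m + 1) → S)) := {e | ∀ k, (e k).1 = false} with hAdef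
  have hA : MeasurableSet A := by
    have : A = ⋂ k : ℕ, (fun e : ℕ → Bool × (Fin (m + 1) → S) => (e k).1) ⁻¹' {false} := by
      ext e; simp [hAdef]
    rw [this]
    exact MeasurableSet.iInter fun k =>
      (measurable_fst.comp (measurable_pi_apply k)) (measurableSet_singleton false)
  have hstep : ∀ x, splitKernel κ m δ ν hC x A =
      ∫⁻ w, (1 - splitDensity κ m C δ ν x (w (Fin.last m))) *
        splitKernel κ m δ ν hC (w (Fin.last m)) A ∂(blockLaw κ m x) := by
    intro x
    rw [← lintegral_indicator_one hA,
      lintegral_splitKernel_block κ δ ν hC x (measurable_one.indicator hA)]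
    refine lintegral_congr fun w => ?_
    have h1 : ∀ e, A.indicator (1 : (ℕ → Bool × (Fin (m + 1) → S)) → ℝ≥0∞)
        (consPath (true, w) e) = 0 := fun e =>
      Set.indicator_of_notMem (fun h => by simpa using h 0) _
    have h2 : ∀ e, A.indicator (1 : (ℕ → Bool × (Fin (m + 1) → S)) → ℝ≥0∞)
        (consPath (false, w) e) = A.indicator 1 e := by
      intro e
      have : consPath (false, w) e ∈ A ↔ e ∈ A :=
        ⟨fun h k => h (k + 1), fun h k => by cases k; exacts [rfl, h _]⟩
      by_cases h : e ∈ A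
      · rw [Set.indicator_of_mem h, Set.indicator_of_mem (this.2 h)]; rfl
      · rw [Set.indicator_of_notMem h, Set.indicator_of_notMem (fun h' => h (this.1 h'))]
    simp only [h1, h2, lintegral_zero, mul_zero, zero_add, lintegral_indicator_one hA]
  -- Contraction again: from a point of `C` the chain fails to regenerate in the present block with
  -- probability `1 - δ`. As the skeleton reaches `C` from anywhere, `M ≤ (1 - δ) * M`.
  set M : ℝ≥0∞ := ⨆ x, splitKernel κ m δ ν hC x A with hMdef
  have hle : ∀ x, splitKernel κ m δ ν hC x A ≤ M := fun x =>
    le_iSup (fun x => splitKernel κ m δ ν hC x A) x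
  have hM1 : M ≤ 1 := iSup_le fun x => prob_le_one
  have hCle : ∀ x ∈ C, splitKernel κ m δ ν hC x A ≤ ENNReal.ofReal (1 - δ) * M := by
    intro x hx
    have hDm := measurable_splitDensity_last (m := m) κ δ ν hC x
    rw [hstep, ← lintegral_one_sub_splitDensity κ m hC hδ hmin hx,
      ← lintegral_mul_const _ (by fun_prop)]
    exact lintegral_mono fun w => by gcongr; exact hle _
  set h : ℕ → Set (ℕ → S) := fun n => {X | ∀ k < n, X (k * m) ∉ C} with hh
  have hhm : ∀ n, MeasurableSet (h n) := by
    intro n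
    have : h n = ⋂ k : ℕ, ⋂ _ : k < n, (fun X : ℕ → S => X (k * m)) ⁻¹' Cᶜ := by
      ext X; simp [hh]
    rw [this]
    exact MeasurableSet.iInter fun k => MeasurableSet.iInter fun _ =>
      measurable_pi_apply (k * m) hC.compl
  -- Either the skeleton has not met `C` within `n` blocks, or the bound on `C` applies at its first
  -- visit; the former probability vanishes as `n` grows.
  have hind : ∀ n x, splitKernel κ m δ ν hC x A ≤
      pathLaw κ x (h n) + ENNReal.ofReal (1 - δ) * M := by
    intro n
    induction n with
    | zero => intro x; simpa [hh] using le_add_right prob_le_one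
    | succ n ih =>
      intro x
      by_cases hx : x ∈ C
      · exact (hCle x hx).trans le_add_self
      have e : pathLaw κ x (h (n + 1)) =
          ∫⁻ w, pathLaw κ (w (Fin.last m)) (h n) ∂(blockLaw κ m x) := by
        have hF : Measurable (Function.uncurry fun (_ : Fin (m + 1) → S) (X : ℕ → S) =>
            (h n).indicator (1 : (ℕ → S) → ℝ≥0∞) X) :=
          (measurable_one.indicator (hhm n)).comp measurable_snd
        have h3 := lintegral_pathLaw_block κ m x hF
        simp only [lintegral_indicator_one (hhm n)] at h3
        rw [← h3, ← lintegral_indicator_one (hhm (n + 1))]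
        refine lintegral_congr_ae ?_
        filter_upwards [ae_pathLaw_zero κ x (p := (· ∉ C)) hC.compl hx] with X hX
        have : X ∈ h (n + 1) ↔ shiftPath m X ∈ h n := by
          constructor
          · intro hX' k hk
            have := hX' (k + 1) (by omega)
            convert this using 2; simp only [shiftPath_apply]; congr 1; ring
          · intro hX' k hk
            cases k with
            | zero => simpa using hX
            | succ k =>
              have := hX' k (by omega)
              convert this using 2; simp only [shiftPath_apply]; congr 1; ring
        by_cases hXn : shiftPath m X ∈ h n
        · rw [Set.indicator_of_mem hXn, Set.indicator_of_mem (this.2 hXn)]; rfl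
        · rw [Set.indicator_of_notMem hXn, Set.indicator_of_notMem fun h' => hXn (this.1 h')]
      rw [hstep, e]
      calc _ ≤ ∫⁻ w, (pathLaw κ (w (Fin.last m)) (h n) + ENNReal.ofReal (1 - δ) * M)
            ∂(blockLaw κ m x) := lintegral_mono fun w => by
              calc _ ≤ 1 * splitKernel κ m δ ν hC (w (Fin.last m)) A := by
                    gcongr; exact tsub_le_self
                _ ≤ _ := by rw [one_mul]; exact ih _
        _ = _ := by rw [lintegral_add_right _ measurable_const]; simp
  have hlim : ∀ x, splitKernel κ m δ ν hC x A ≤ ENNReal.ofReal (1 - δ) * M := by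
    intro x
    have hanti : Antitone h := fun a b hab X hX k hk => hX k (hk.trans_le hab)
    have ht := tendsto_measure_iInter_atTop (μ := pathLaw κ x)
      (fun n => (hhm n).nullMeasurableSet) hanti ⟨0, measure_ne_top _ _⟩
    have h0 : pathLaw κ x (⋂ n, h n) = 0 := by
      refine measure_mono_null ?_ (hrec x)
      intro X hX n hn
      obtain ⟨k, rfl⟩ : m ∣ n := by simpa using hn
      rw [mul_comm]
      exact Set.mem_iInter.1 hX (k + 1) k k.lt_succ_self
    rw [h0] at ht
    have := ht.add_const (ENNReal.ofReal (1 - δ) * M)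
    rw [zero_add] at this
    exact ge_of_tendsto' this fun n => hind n x
  have h0 : M = 0 := eq_zero_of_le_mul (c := ENNReal.ofReal (1 - δ)) (by simpa using hδ)
    (hM1.trans_lt ENNReal.one_lt_top).ne (iSup_le hlim)
  exact le_antisymm ((hle x).trans h0.le) zero_le

/-- Almost surely, the split chain regenerates infinitely often. -/
theorem ae_splitLaw_infinite [IsProbabilityMeasure ν] (hC : MeasurableSet C)
    (hδ : 0 < δ) (hmin : Minorizes κ m C δ ν)
    (hrec : ∀ x, pathLaw κ x (avoiding m C 0) = 0) (μ : Measure S) :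
    ∀ᵐ e ∂(splitLaw κ m hC δ ν μ), {k | (e k).1 = true}.Infinite := by
  have hMk := isMarkovKernel_splitKernel κ m δ ν hC
  set A : ℕ → Set (ℕ → Bool × (Fin (m + 1) → S)) :=
    fun N => {e | ∀ k, N ≤ k → (e k).1 = false} with hAdef
  have hA : ∀ N, MeasurableSet (A N) := by
    intro N
    have : A N = ⋂ k : ℕ, ⋂ _ : N ≤ k,
        (fun e : ℕ → Bool × (Fin (m + 1) → S) => (e k).1) ⁻¹' {false} := by
      ext e; simp [hAdef]
    rw [this]
    exact MeasurableSet.iInter fun k => MeasurableSet.iInter fun _ =>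
      (measurable_fst.comp (measurable_pi_apply k)) (measurableSet_singleton false)
  have hzero : ∀ N x, splitKernel κ m δ ν hC x (A N) = 0 := by
    intro N
    induction N with
    | zero =>
      intro x
      simpa [hAdef] using splitKernel_forall_not_eq_zero κ hC hδ hmin hrec x
    | succ N ih =>
      intro x
      have h1 : ∀ (e₀ : Bool × (Fin (m + 1) → S)) (e : ℕ → Bool × (Fin (m + 1) → S)),
          (A (N + 1)).indicator (1 : (ℕ → Bool × (Fin (m + 1) → S)) → ℝ≥0∞) (consPath e₀ e) =
            (A N).indicator 1 e := by
        intro e₀ e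
        have : consPath e₀ e ∈ A (N + 1) ↔ e ∈ A N :=
          ⟨fun h k hk => h (k + 1) (by omega), fun h k hk => by
            cases k with
            | zero => omega
            | succ k => exact h k (by omega)⟩
        by_cases h : e ∈ A N
        · rw [Set.indicator_of_mem h, Set.indicator_of_mem (this.2 h)]; rfl
        · rw [Set.indicator_of_notMem h, Set.indicator_of_notMem (fun h' => h (this.1 h'))]
      rw [← lintegral_indicator_one (hA _),
        lintegral_splitKernel κ m δ ν hC x (measurable_one.indicator (hA _))]
      simp [h1, lintegral_indicator_one (hA N), ih]
  have hnull : ∀ N, ∀ᵐ e ∂(splitLaw κ m hC δ ν μ), e ∉ A N := by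
    intro N
    rw [ae_iff]
    simp only [not_not, Set.ofPred_mem_eq]
    rw [← lintegral_indicator_one (hA N),
      lintegral_splitLaw κ m δ ν hC μ (measurable_one.indicator (hA N))]
    simp [lintegral_indicator_one (hA N), hzero]
  filter_upwards [ae_all_iff.2 hnull] with e he
  rw [← Nat.frequently_atTop_iff_infinite, Filter.frequently_atTop]
  intro N
  have := he N
  simp only [hAdef, Set.mem_ofPred_eq, not_forall] at this
  obtain ⟨k, hk, h⟩ := this
  exact ⟨k, hk, by simpa using h⟩

end Regeneration
end Estimates

/-! ### Hölder's inequality and exponential Orlicz norms. -/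

/-- A three-function Hölder inequality, one of the functions being bounded by `1`. -/
theorem lintegral_mul_rpow_mul_rpow_le {Ω : Type*} [MeasurableSpace Ω] {μ : Measure Ω}
    {F A B : Ω → ℝ≥0∞} (hF : Measurable F) (hA : Measurable A) (hB : Measurable B)
    (hF1 : ∀ ω, F ω ≤ 1) {s t : ℝ} (hs : 0 ≤ s) (ht : 0 ≤ t) (hst : s + t ≤ 1) {ε : ℝ≥0∞}
    (hFε : ∫⁻ ω, F ω ∂μ ≤ ε) (hA2 : ∫⁻ ω, A ω ∂μ ≤ 2) (hB2 : ∫⁻ ω, B ω ∂μ ≤ 2) :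
    ∫⁻ ω, F ω * (A ω ^ s * B ω ^ t) ∂μ ≤ 2 ^ (s + t) * ε ^ (1 - (s + t)) := by
  -- The exponents must add up to `1`, so `F` takes the remaining `1 - (s + t)`. This only enlarges
  -- the integrand, since `F ≤ 1`.
  have h := ENNReal.lintegral_prod_norm_pow_le (μ := μ) (Finset.univ : Finset (Fin 3))
    (f := ![F, A, B]) (p := ![1 - (s + t), s, t])
    (by intro i _; fin_cases i; exacts [hF.aemeasurable, hA.aemeasurable, hB.aemeasurable])
    (by simp [Fin.sum_univ_three]; ring)
    (by intro i _; fin_cases i; exacts [by simpa using hst, hs, ht])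
  simp only [Fin.prod_univ_three, Matrix.cons_val_zero, Matrix.cons_val_one,
    Matrix.cons_val] at h
  calc _ ≤ ∫⁻ ω, F ω ^ (1 - (s + t)) * A ω ^ s * B ω ^ t ∂μ := by
        refine lintegral_mono fun ω => ?_
        rw [mul_assoc]
        gcongr
        calc F ω = F ω ^ (1 : ℝ) := (ENNReal.rpow_one _).symm
          _ ≤ _ := ENNReal.rpow_le_rpow_of_exponent_ge (hF1 ω) (by linarith)
    _ ≤ _ := h
    _ ≤ ε ^ (1 - (s + t)) * 2 ^ s * 2 ^ t := by
        gcongr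
    _ = _ := by
        rw [ENNReal.rpow_add s t two_ne_zero ENNReal.ofNat_ne_top]; ring

/-- The Orlicz function `s ↦ exp (|s|^α / c^α)`. -/
def expFun (α c s : ℝ) : ℝ≥0∞ := ENNReal.ofReal (Real.exp (|s| ^ α / c ^ α))

theorem measurable_expFun (α c : ℝ) : Measurable (expFun α c) := by
  unfold expFun; fun_prop

theorem expFun_abs (α c s : ℝ) : expFun α c |s| = expFun α c s := by simp [expFun]

theorem expFun_zero {α : ℝ} (hα : 0 < α) (c : ℝ) : expFun α c 0 = 1 := by
  simp [expFun, Real.zero_rpow hα.ne']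

theorem one_le_expFun {α c : ℝ} (hc : 0 < c) (s : ℝ) : 1 ≤ expFun α c s := by
  rw [expFun, ENNReal.one_le_ofReal, Real.one_le_exp_iff]
  positivity

/-- The map `u ↦ u ^ α` is subadditive on nonnegative reals; this is where `α ≤ 1` enters. -/
theorem expFun_add_le {α c : ℝ} (hα : 0 < α) (hα1 : α ≤ 1) (hc : 0 < c) (s t : ℝ) :
    expFun α c (s + t) ≤ expFun α c s * expFun α c t := by
  rw [expFun, expFun, expFun, ← ENNReal.ofReal_mul (Real.exp_nonneg _), ← Real.exp_add]
  refine ENNReal.ofReal_le_ofReal (Real.exp_le_exp.2 ?_)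
  rw [← add_div]
  refine div_le_div_of_nonneg_right ?_ (by positivity)
  exact (Real.rpow_le_rpow (abs_nonneg _) (abs_add_le s t) hα.le).trans
    (Real.rpow_add_le_add_rpow (abs_nonneg _) (abs_nonneg _) hα.le hα1)

theorem expFun_rpow (α c k t s : ℝ) (h : t / k ^ α = 1 / c ^ α) :
    expFun α k s ^ t = expFun α c s := by
  rw [expFun, expFun, ENNReal.ofReal_rpow_of_pos (Real.exp_pos _), ← Real.exp_mul]
  congr 2
  calc |s| ^ α / k ^ α * t = |s| ^ α * (t / k ^ α) := by ring
    _ = _ := by rw [h]; ring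

theorem expFun_anti {α c k : ℝ} (hα : 0 < α) (hc : 0 < c) (hck : c ≤ k) (s : ℝ) :
    expFun α k s ≤ expFun α c s := by
  refine ENNReal.ofReal_le_ofReal (Real.exp_le_exp.2 ?_)
  exact div_le_div_of_nonneg_left (by positivity) (by positivity)
    (Real.rpow_le_rpow hc.le hck hα.le)

section psiNorm

variable {Ω : Type*} [MeasurableSpace Ω] {μ : Measure Ω} {α : ℝ} {Y : Ω → ℝ}

theorem psiNorm_le {c : ℝ} (hc : 0 < c) (h : ∫⁻ ω, expFun α c (Y ω) ∂μ ≤ 2) :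
    psiNorm α μ Y ≤ ENNReal.ofReal c :=
  iInf_le_of_le c (iInf_le_of_le hc (iInf_le_of_le h le_rfl))

/-- Strict inequality produces an admissible parameter below `k`, and the integral decreases in the
parameter; attainment of the infimum plays no role. -/
theorem lintegral_expFun_le_two (hα : 0 < α) {k : ℝ} (h : psiNorm α μ Y < ENNReal.ofReal k) :
    ∫⁻ ω, expFun α k (Y ω) ∂μ ≤ 2 := by
  simp only [psiNorm, iInf_lt_iff] at h
  obtain ⟨c, hc, h2, hck⟩ := h
  have hck' : c < k := (ENNReal.ofReal_lt_ofReal_iff_of_nonneg hc.le).1 hck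
  exact (lintegral_mono fun ω => expFun_anti hα hc hck'.le _).trans h2

end psiNorm

/-- Passage to the limit in the parameters of a bound on an Orlicz norm. -/
theorem le_ofReal_mul_of_forall_lt {α r : ℝ} (hα : 0 < α) (hr : 0 < r) {N K D : ℝ≥0∞}
    (h : ∀ k d : ℝ, 0 < k → 0 < d → K < ENNReal.ofReal k → D < ENNReal.ofReal d →
      N ≤ ENNReal.ofReal ((r * (k ^ α + d ^ α)) ^ (1 / α))) :
    N ≤ ENNReal.ofReal (r ^ (1 / α)) * (K ^ α + D ^ α) ^ (1 / α) := by
  have hr0 : ENNReal.ofReal (r ^ (1 / α)) ≠ 0 := by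
    simpa using Real.rpow_pos_of_pos hr _
  by_cases hK : K = ∞
  · rw [hK, ENNReal.top_rpow_of_pos hα, top_add,
      ENNReal.top_rpow_of_pos (by positivity), ENNReal.mul_top hr0]
    exact le_top
  by_cases hD : D = ∞
  · rw [hD, ENNReal.top_rpow_of_pos hα, add_top,
      ENNReal.top_rpow_of_pos (by positivity), ENNReal.mul_top hr0]
    exact le_top
  lift K to NNReal using hK
  lift D to NNReal using hD
  -- The hypothesis is applied to `K + t` and `D + t` with `t > 0`, which are positive even when `K`
  -- or `D` vanishes, and `t` decreases to `0`.
  have hcont : Continuous fun t : ℝ =>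
      ENNReal.ofReal ((r * (((K : ℝ) + t) ^ α + ((D : ℝ) + t) ^ α)) ^ (1 / α)) := by
    refine ENNReal.continuous_ofReal.comp (Continuous.rpow_const ?_ fun _ => Or.inr (by positivity))
    refine continuous_const.mul (Continuous.add ?_ ?_) <;>
    exact Continuous.rpow_const (by fun_prop) fun _ => Or.inr hα.le
  have ht := (hcont.tendsto 0).mono_left (nhdsWithin_le_nhds (s := Set.Ioi (0 : ℝ)))
  have heq : ENNReal.ofReal ((r * (((K : ℝ) + 0) ^ α + ((D : ℝ) + 0) ^ α)) ^ (1 / α)) =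
      ENNReal.ofReal (r ^ (1 / α)) * ((K : ℝ≥0∞) ^ α + (D : ℝ≥0∞) ^ α) ^ (1 / α) := by
    rw [add_zero, add_zero, Real.mul_rpow hr.le (by positivity),
      ENNReal.ofReal_mul (by positivity),
      ← ENNReal.ofReal_rpow_of_nonneg (x := (K : ℝ) ^ α + (D : ℝ) ^ α) (by positivity)
        (by positivity),
      ENNReal.ofReal_add (by positivity) (by positivity),
      ← ENNReal.ofReal_rpow_of_nonneg (NNReal.coe_nonneg _) hα.le,
      ← ENNReal.ofReal_rpow_of_nonneg (NNReal.coe_nonneg _) hα.le,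
      ENNReal.ofReal_coe_nnreal, ENNReal.ofReal_coe_nnreal]
  rw [heq] at ht
  refine ge_of_tendsto ht ?_
  filter_upwards [self_mem_nhdsWithin] with t ht'
  have ht0 : (0 : ℝ) < t := ht'
  have hlt : ∀ x : NNReal, (x : ℝ≥0∞) < ENNReal.ofReal ((x : ℝ) + t) := fun x => by
    rw [← ENNReal.ofReal_coe_nnreal, ENNReal.ofReal_lt_ofReal_iff (by positivity)]
    linarith
  exact h _ _ (by positivity) (by positivity) (hlt K) (hlt D)

/-! ### The exponent `r` and the constants of the recursion. -/

section Exponent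

theorem isExponent_one_iff (r : ℝ) : IsExponent 1 r ↔ r = 1 := by
  constructor
  · rintro ⟨h1, h2⟩
    simp only [Real.one_rpow, mul_one, if_true, add_zero] at h2
    have h3 : (2 : ℝ) ^ (1 / r) = 2 ^ (1 : ℝ) := by rw [h2, Real.rpow_one]
    have h4 : 1 / r = 1 := by
      simpa using congrArg (Real.logb 2) h3
    have : r ≠ 0 := by positivity
    field_simp at h4
    exact h4.symm
  · rintro rfl
    simp [IsExponent]

theorem existsUnique_isExponent {δ : ℝ} (hδ : 0 < δ) (hδ1 : δ ≤ 1) :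
    ∃! r : ℝ, IsExponent δ r := by
  rcases hδ1.eq_or_lt with rfl | hlt
  · exact ⟨1, (isExponent_one_iff 1).2 rfl, fun r hr => (isExponent_one_iff r).1 hr⟩
  have hε : 0 < 1 - δ := by linarith
  -- In the variable `t = 1 / r` this is a positive combination of exponentials with bases `2 / δ`
  -- and `2 / (1 - δ)`, both above `1`. It increases strictly from `2 - δ` at `0` to `6` at `1`,
  -- hence takes the value `2` exactly once there.
  set h : ℝ → ℝ := fun t => 2 ^ t * δ ^ (1 - t) + 2 ^ (1 + t) * (1 - δ) ^ (1 - t) with hh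
  have e1 : ∀ {x : ℝ}, 0 < x → ∀ t : ℝ, (2 : ℝ) ^ t * x ^ (1 - t) = x * (2 / x) ^ t := by
    intro x hx t
    rw [Real.div_rpow zero_le_two hx.le, Real.rpow_sub hx, Real.rpow_one]
    ring
  have e2 : ∀ t, h t = δ * (2 / δ) ^ t + 2 * ((1 - δ) * (2 / (1 - δ)) ^ t) := by
    intro t
    rw [hh, ← e1 hδ, ← e1 hε]
    simp only
    rw [Real.rpow_add two_pos, Real.rpow_one]
    ring
  have hmono : StrictMono h := by
    intro s t hst
    rw [e2, e2]
    have h1 : (1 : ℝ) < 2 / δ := by rw [lt_div_iff₀ hδ]; linarith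
    have h2 : (1 : ℝ) < 2 / (1 - δ) := by rw [lt_div_iff₀ hε]; linarith
    have h3 := Real.rpow_lt_rpow_of_exponent_lt h1 hst
    have h4 := Real.rpow_lt_rpow_of_exponent_lt h2 hst
    gcongr
  have hcont : Continuous h := by
    have : h = fun t => δ * (2 / δ) ^ t + 2 * ((1 - δ) * (2 / (1 - δ)) ^ t) := funext e2
    rw [this]
    have h1 : Continuous fun t : ℝ => (2 / δ) ^ t :=
      Real.continuous_const_rpow (by positivity)
    have h2 : Continuous fun t : ℝ => (2 / (1 - δ)) ^ t :=
      Real.continuous_const_rpow (by positivity)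
    fun_prop
  have h0 : h 0 < 2 := by rw [e2]; simp; linarith
  have h1 : 2 < h 1 := by simp only [hh]; norm_num
  obtain ⟨t, ht, hht⟩ := intermediate_value_Icc zero_le_one hcont.continuousOn
    (show (2 : ℝ) ∈ Set.Icc (h 0) (h 1) from ⟨h0.le, h1.le⟩)
  have ht0 : 0 < t := lt_of_le_of_ne ht.1 (by rintro rfl; linarith)
  refine ⟨1 / t, ⟨?_, ?_⟩, ?_⟩
  · rw [le_div_iff₀ ht0]; linarith [ht.2]
  · simpa [hlt.ne, hh] using hht
  · rintro r ⟨hr1, hr2⟩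
    rw [if_neg hlt.ne] at hr2
    have : 1 / r = t := hmono.injective (by rw [hht]; exact hr2)
    rw [← this, one_div_one_div]

end Exponent

section Constants

/-- The constants of the recursion: with `p = 2^b δ^{1-b}`, `q = 2^{a+b} (1-δ)^{1-(a+b)}` and
`g = 2^{1-a} δ^a`, where `a + b = 1 / r`, one has `p + q g = g`. -/
theorem recursion_constants {δ r a b : ℝ} (hδ : 0 < δ) (hδ1 : δ ≤ 1) (hr : IsExponent δ r)
    (hab : a + b = 1 / r) :
    (2 : ℝ≥0∞) ^ b * ENNReal.ofReal δ ^ (1 - b) +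
      (if δ = 1 then 0 else 2 ^ (a + b) * ENNReal.ofReal (1 - δ) ^ (1 - (a + b))) *
        (2 ^ (1 - a) * ENNReal.ofReal δ ^ a) = 2 ^ (1 - a) * ENNReal.ofReal δ ^ a := by
  obtain ⟨hr1, hr2⟩ := hr
  rw [← hab] at hr2
  have h2 : (2 : ℝ≥0∞) = ENNReal.ofReal 2 := by simp
  have hq : (if δ = 1 then (0 : ℝ≥0∞) else 2 ^ (a + b) * ENNReal.ofReal (1 - δ) ^ (1 - (a + b))) =
      ENNReal.ofReal (if δ = 1 then 0 else (2 : ℝ) ^ (a + b) * (1 - δ) ^ (1 - (a + b))) := by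
    split_ifs with h
    · simp
    · have : 0 < 1 - δ := by
        have := lt_of_le_of_ne hδ1 h
        linarith
      rw [h2, ENNReal.ofReal_rpow_of_pos two_pos, ENNReal.ofReal_rpow_of_pos this,
        ← ENNReal.ofReal_mul (by positivity)]
  have hq0 : 0 ≤ (if δ = 1 then 0 else (2 : ℝ) ^ (a + b) * (1 - δ) ^ (1 - (a + b))) := by
    split_ifs with h
    · exact le_rfl
    · have : 0 ≤ 1 - δ := by linarith
      positivity
  rw [hq, h2, ENNReal.ofReal_rpow_of_pos two_pos, ENNReal.ofReal_rpow_of_pos two_pos,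
    ENNReal.ofReal_rpow_of_pos hδ, ENNReal.ofReal_rpow_of_pos hδ,
    ← ENNReal.ofReal_mul (by positivity), ← ENNReal.ofReal_mul (by positivity),
    ← ENNReal.ofReal_mul hq0, ← ENNReal.ofReal_add (by positivity)
      (mul_nonneg hq0 (by positivity))]
  congr 1
  have hQ : (if δ = 1 then 0 else (2 : ℝ) ^ (1 + (a + b)) * (1 - δ) ^ (1 - (a + b))) =
      2 * (if δ = 1 then 0 else (2 : ℝ) ^ (a + b) * (1 - δ) ^ (1 - (a + b))) := by
    split_ifs
    · simp
    · rw [Real.rpow_add two_pos 1, Real.rpow_one]; ring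
  rw [hQ] at hr2
  have hP : (2 : ℝ) ^ (a + b) * δ ^ (1 - (a + b)) * (2 ^ (1 - a) * δ ^ a) =
      2 * (2 ^ b * δ ^ (1 - b)) := by
    rw [show 1 - b = (1 - (a + b)) + a by ring, Real.rpow_add hδ (1 - (a + b)) a,
      show (2 : ℝ) * (2 ^ b * (δ ^ (1 - (a + b)) * δ ^ a)) =
        2 ^ (1 : ℝ) * 2 ^ b * (δ ^ (1 - (a + b)) * δ ^ a) by rw [Real.rpow_one]; ring,
      ← Real.rpow_add two_pos, show (1 : ℝ) + b = (a + b) + (1 - a) by ring,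
      Real.rpow_add two_pos (a + b)]
    ring
  -- By `hr2`, `2 (1 - q) = 2^(a+b) δ^(1-(a+b))`; by `hP`, this quantity times `g` is `2 p`.
  -- Together, `p = (1 - q) g`.
  linear_combination (2 ^ (1 - a) * δ ^ a / 2) * hr2 - hP / 2

theorem two_rpow_mul_rpow_mul (δ : ℝ≥0∞) (a : ℝ) :
    2 ^ (1 - a) * δ ^ a * 2 ^ a = 2 * δ ^ a := by
  rw [mul_right_comm, ← ENNReal.rpow_add _ _ two_ne_zero ENNReal.ofNat_ne_top, sub_add_cancel,
    ENNReal.rpow_one]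

end Constants

/-! ### Block sums, and the return time to `C`. -/

section Blocks

variable {S : Type*} {m : ℕ}

/-- The sum of `f` over the points of a block except the last one. -/
def blockSum (f : S → ℝ) (w : Fin (m + 1) → S) : ℝ := ∑ j : Fin m, f (w j.castSucc)

theorem measurable_blockSum [MeasurableSpace S] {f : S → ℝ} (hf : Measurable f) :
    Measurable (blockSum (m := m) f) :=
  Finset.measurable_sum _ fun _ _ => hf.comp (measurable_pi_apply _)

theorem Z_eq_blockSum (f : S → ℝ) (X : ℕ → S) (k : ℕ) :
    Z m f X k = blockSum f (initBlock m (shiftPath (k * m) X)) := by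
  simp [Z, blockSum, initBlock, Finset.sum_range]

theorem Z_splitX_eq_blockSum (hm : 1 ≤ m) (f : S → ℝ) (e : ℕ → Bool × (Fin (m + 1) → S)) (k : ℕ) :
    Z m f (splitX e) k = blockSum f (e k).2 := by
  simp only [Z, blockSum, Finset.sum_range, splitX]
  refine Finset.sum_congr rfl fun j _ => ?_
  have h1 : (k * m + j) / m = k := by
    rw [mul_comm, Nat.mul_add_div (by omega), Nat.div_eq_of_lt j.2, add_zero]
  have h2 : (k * m + j) % m = j := by
    rw [mul_comm, Nat.mul_add_mod, Nat.mod_eq_of_lt j.2]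
  have h3 : Fin.ofNat (m + 1) (j : ℕ) = j.castSucc :=
    Fin.ext (by simp [Fin.ofNat, Nat.mod_eq_of_lt (Nat.lt_succ_of_lt j.2)])
  rw [h1, h2, h3]

theorem tauC_eq {C : Set S} {X : ℕ → S} {T : ℕ} (hT : 1 ≤ T) (h : X (T * m) ∈ C)
    (hlt : ∀ k, 1 ≤ k → k < T → X (k * m) ∉ C) : tauC m C X = T := by
  refine IsLeast.csInf_eq ⟨⟨hT, h⟩, fun k hk => ?_⟩
  by_contra! hk'
  exact hlt k hk.1 hk' hk.2

variable {C : Set S} {z : (Fin (m + 1) → S) → ℝ} {φ : ℝ → ℝ≥0∞}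

/-- If the truncated functional is nonzero, the shifted path has met `C` and the sum is the genuine
one; otherwise the left side is `0`. The default value of `tauC` on paths that never return
therefore does no harm. -/
theorem hitFun_shiftPath_le (n : ℕ) (X : ℕ → S) :
    hitFun C z φ n 0 (shiftPath m X) ≤
      φ (∑ i ∈ Finset.Ico 1 (tauC m C X), z (initBlock m (shiftPath (i * m) X))) := by
  have e : ∀ k : ℕ, m + k * m = (k + 1) * m := fun k => by ring
  rcases hitFun_eq_zero_or C z φ n 0 (shiftPath m X) with h | ⟨T, h1, h2, h3⟩
  · rw [h]; exact zero_le
  · simp only [shiftPath_apply, e] at h1 h2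
    have hτ : tauC m C X = T + 1 := by
      refine tauC_eq (by omega) h1 fun k hk1 hk => ?_
      obtain ⟨k, rfl⟩ := Nat.exists_eq_add_of_le' hk1
      exact h2 k (by omega)
    rw [h3, hτ, Finset.sum_Ico_eq_sum_range]
    refine le_of_eq ?_
    rw [zero_add, Nat.add_sub_cancel]
    congr 1
    refine Finset.sum_congr rfl fun i _ => ?_
    congr 2
    funext j
    simp only [shiftPath_apply]
    congr 1; ring

/-- For a path starting in `C` the functional stops at time `0`, while `tauC` looks only at times
from `1` on; the assumption on `φ 0` covers this mismatch. -/
theorem hitFun_le (hφ0 : ∀ s, φ 0 ≤ φ s) (n : ℕ) (X : ℕ → S) :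
    hitFun C z φ n 0 X ≤
      φ (∑ i ∈ Finset.range (tauC m C X), z (initBlock m (shiftPath (i * m) X))) := by
  rcases hitFun_eq_zero_or C z φ n 0 X with h | ⟨T, h1, h2, h3⟩
  · rw [h]; exact zero_le
  · rcases Nat.eq_zero_or_pos T with rfl | hT
    · rw [h3]; simpa using hφ0 _
    · rw [h3, tauC_eq hT h1 fun k _ hk => h2 k hk, zero_add]

end Blocks

/-! ### Moment bounds by Hölder, and removal of the truncation. -/

section Main

variable {S : Type*} [MeasurableSpace S] (κ : Kernel S S)
  [IsMarkovKernel κ] {m : ℕ} {C : Set S} {z : (Fin (m + 1) → S) → ℝ} {φ A B : ℝ → ℝ≥0∞}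

/-- The estimate of a weighted block sum followed by an excursion to `C`. -/
theorem lintegral_weight_mul_le (hC : MeasurableSet C) (hz : Measurable z) (hφ : Measurable φ)
    (hA : Measurable A) (hB : Measurable B) {a b : ℝ} (ha : 0 < a) (hb : 0 ≤ b) (hab : a + b ≤ 1)
    (hφA : ∀ s, A s ^ a = φ s) (hφB : ∀ s, B s ^ b = φ s) {x : S}
    (hAx : ∀ n, ∫⁻ X, hitFun C z A n 0 (shiftPath m X) ∂(pathLaw κ x) ≤ 2)
    (hBx : ∫⁻ w, B (z w) ∂(blockLaw κ m x) ≤ 2)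
    {F : (Fin (m + 1) → S) → ℝ≥0∞} (hF : Measurable F) (hF1 : ∀ w, F w ≤ 1) {ε : ℝ≥0∞}
    (hε : ∫⁻ w, F w ∂(blockLaw κ m x) ≤ ε) (n : ℕ) :
    ∫⁻ w, F w * (φ (z w) * ∫⁻ X, hitFun C z φ n 0 X ∂(pathLaw κ (w (Fin.last m))))
      ∂(blockLaw κ m x) ≤ 2 ^ (a + b) * ε ^ (1 - (a + b)) := by
  have hH : ∀ {ψ : ℝ → ℝ≥0∞}, Measurable ψ → Measurable fun X => hitFun C z ψ n 0 X :=
    fun hψ => (measurable_hitFun hC hz hψ n).comp (f := fun X : ℕ → S => ((0 : ℝ), X))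
      (by fun_prop)
  have hφz : Measurable fun w : Fin (m + 1) → S => φ (z w) := hφ.comp hz
  have hBz : Measurable fun w : Fin (m + 1) → S => B (z w) := hB.comp hz
  have hHφ := hH hφ
  have hHA := hH hA
  have h1 := lintegral_pathLaw_block κ m x
    (F := fun w X => F w * (φ (z w) * hitFun C z φ n 0 X)) (by
      exact (hF.comp measurable_fst).mul ((hφz.comp measurable_fst).mul
        (hHφ.comp measurable_snd)))
  have h2 : ∀ w : Fin (m + 1) → S,
      ∫⁻ X, F w * (φ (z w) * hitFun C z φ n 0 X) ∂(pathLaw κ (w (Fin.last m))) =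
      F w * (φ (z w) * ∫⁻ X, hitFun C z φ n 0 X ∂(pathLaw κ (w (Fin.last m)))) := fun w => by
    rw [lintegral_const_mul _ (hHφ.const_mul _), lintegral_const_mul _ hHφ]
  simp only [h2] at h1
  rw [← h1]
  have h3 : (fun u => A u ^ a) = φ := funext hφA
  have h4 : ∀ X, F (initBlock m X) * (φ (z (initBlock m X)) *
      hitFun C z φ n 0 (shiftPath m X)) = F (initBlock m X) *
        (hitFun C z A n 0 (shiftPath m X) ^ a * B (z (initBlock m X)) ^ b) := fun X => by
    rw [hitFun_rpow C z A ha, h3, hφB, mul_comm (φ _)]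
  simp only [h4]
  rw [lintegral_blockLaw κ m x hF] at hε
  rw [lintegral_blockLaw κ m x hBz] at hBx
  exact lintegral_mul_rpow_mul_rpow_le (hF.comp (measurable_initBlock m))
    (hHA.comp (measurable_shiftPath m)) (hBz.comp (measurable_initBlock m))
    (fun _ => hF1 _) ha.le hb hab hε (hAx n) hBx

/-- The estimate of an excursion to `C` after a weighted block. -/
theorem lintegral_weight_mul_hitFun_le (hC : MeasurableSet C) (hz : Measurable z)
    (hφ : Measurable φ) (hA : Measurable A) {a : ℝ} (ha : 0 < a) (ha1 : a ≤ 1)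
    (hφA : ∀ s, A s ^ a = φ s) {x : S}
    (hAx : ∀ n, ∫⁻ X, hitFun C z A n 0 (shiftPath m X) ∂(pathLaw κ x) ≤ 2)
    {F : (Fin (m + 1) → S) → ℝ≥0∞} (hF : Measurable F) (hF1 : ∀ w, F w ≤ 1) {ε : ℝ≥0∞}
    (hε : ∫⁻ w, F w ∂(blockLaw κ m x) ≤ ε) (n : ℕ) :
    ∫⁻ w, F w * ∫⁻ X, hitFun C z φ n 0 X ∂(pathLaw κ (w (Fin.last m)))
      ∂(blockLaw κ m x) ≤ 2 ^ a * ε ^ (1 - a) := by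
  have hH : ∀ {ψ : ℝ → ℝ≥0∞}, Measurable ψ → Measurable fun X => hitFun C z ψ n 0 X :=
    fun hψ => (measurable_hitFun hC hz hψ n).comp (f := fun X : ℕ → S => ((0 : ℝ), X))
      (by fun_prop)
  have hHφ := hH hφ
  have hHA := hH hA
  have h1 := lintegral_pathLaw_block κ m x (F := fun w X => F w * hitFun C z φ n 0 X)
    ((hF.comp measurable_fst).mul (hHφ.comp measurable_snd))
  simp only [lintegral_const_mul _ hHφ] at h1
  rw [← h1]
  have h3 : (fun u => A u ^ a) = φ := funext hφA
  have h4 : ∀ X, F (initBlock m X) * hitFun C z φ n 0 (shiftPath m X) = F (initBlock m X) *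
        (hitFun C z A n 0 (shiftPath m X) ^ a * 1 ^ (0 : ℝ)) := fun X => by
    rw [hitFun_rpow C z A ha, h3]; simp
  simp only [h4]
  rw [lintegral_blockLaw κ m x hF] at hε
  have := lintegral_mul_rpow_mul_rpow_le (hF.comp (measurable_initBlock m))
    (hHA.comp (measurable_shiftPath m)) (B := fun _ => 1) measurable_const
    (fun _ => hF1 _) ha.le le_rfl (by linarith) hε (hAx n) (by simp)
  simpa using this

/-- Jensen's inequality for the power `a ≤ 1`, obtained from the Hölder bound with two trivial
factors. -/
theorem lintegral_hitFun_rpow_le {μ : Measure S} [IsProbabilityMeasure μ]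
    (hC : MeasurableSet C) (hz : Measurable z)
    (hA : Measurable A) {a : ℝ} (ha : 0 < a) (ha1 : a ≤ 1)
    (hφA : ∀ s, A s ^ a = φ s) (n : ℕ)
    (h : ∫⁻ X, hitFun C z A n 0 X ∂((pathLaw κ) ∘ₘ μ) ≤ 2) :
    ∫⁻ X, hitFun C z φ n 0 X ∂((pathLaw κ) ∘ₘ μ) ≤ 2 ^ a := by
  have hHA : Measurable fun X => hitFun C z A n 0 X :=
    (measurable_hitFun hC hz hA n).comp (f := fun X : ℕ → S => ((0 : ℝ), X)) (by fun_prop)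
  have h3 : (fun u => A u ^ a) = φ := funext hφA
  have h4 : ∀ X, hitFun C z φ n 0 X = 1 * (hitFun C z A n 0 X ^ a * 1 ^ (0 : ℝ)) := fun X => by
    rw [hitFun_rpow C z A ha, h3]; simp
  simp only [h4]
  have := lintegral_mul_rpow_mul_rpow_le (μ := (pathLaw κ) ∘ₘ μ) (F := fun _ => 1)
    (B := fun _ => 1) measurable_const hHA measurable_const
    (fun _ => le_rfl) ha.le le_rfl (by linarith) (ε := 1) (by simp) h (by simp)
  simpa using this

/-- Fatou's lemma. Measurability is needed only for the approximations, so none has to be proved for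
functionals of `sigma`. -/
theorem lintegral_le_of_eventually_eq {Ω : Type*} [MeasurableSpace Ω] {μ : Measure Ω}
    {G : ℕ → Ω → ℝ≥0∞} {H : Ω → ℝ≥0∞} {B : ℝ≥0∞} (hG : ∀ n, Measurable (G n))
    (hev : ∀ᵐ ω ∂μ, ∀ᶠ n in Filter.atTop, G n ω = H ω) (hB : ∀ n, ∫⁻ ω, G n ω ∂μ ≤ B) :
    ∫⁻ ω, H ω ∂μ ≤ B := by
  calc ∫⁻ ω, H ω ∂μ = ∫⁻ ω, Filter.liminf (fun n => G n ω) Filter.atTop ∂μ := by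
        refine lintegral_congr_ae ?_
        filter_upwards [hev] with ω hω
        exact ((tendsto_const_nhds.congr' (hω.mono fun n hn => hn.symm)).liminf_eq).symm
    _ ≤ Filter.liminf (fun n => ∫⁻ ω, G n ω ∂μ) Filter.atTop := lintegral_liminf_le hG
    _ ≤ B := Filter.liminf_le_of_le (by isBoundedDefault) fun b hb => by
        obtain ⟨n, hn⟩ := hb.exists
        exact hn.trans (hB n)

end Main

/-! ### Exponential moments up to regeneration and over excursions. -/

section Norms

variable {S : Type*} [MeasurableSpace S] [MeasurableSpace.CountablyGenerated S] {κ : Kernel S S}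
  [IsMarkovKernel κ] {m : ℕ} {C : Set S} {δ : ℝ} {ν : Measure S} [IsProbabilityMeasure ν]
  {z : (Fin (m + 1) → S) → ℝ} {φ A B : ℝ → ℝ≥0∞} {a b r : ℝ}

/-- The recursive estimate with `g = 2^(1-a) δ^a`; what remains is to verify the Hölder bounds `p`
and `q` at points of `C`. -/
theorem lintegral_regFun_le_hitFun (hC : MeasurableSet C) (hδ : 0 < δ) (hδ1 : δ ≤ 1)
    (hmin : Minorizes κ m C δ ν) (hr : IsExponent δ r) (hz : Measurable z) (hφ : Measurable φ)
    (hA : Measurable A) (hB : Measurable B) (ha : 0 < a) (hb : 0 < b) (hab : a + b = 1 / r)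
    (hφA : ∀ s, A s ^ a = φ s) (hφB : ∀ s, B s ^ b = φ s)
    (hsub : ∀ s t, φ (s + t) ≤ φ s * φ t) (hφ0 : φ 0 = 1)
    (hAC : ∀ x ∈ C, ∀ n, ∫⁻ X, hitFun C z A n 0 (shiftPath m X) ∂(pathLaw κ x) ≤ 2)
    (hBC : ∀ x ∈ C, ∫⁻ w, B (z w) ∂(blockLaw κ m x) ≤ 2) (n : ℕ) (x : S) :
    ∫⁻ e, regFun z φ n 0 e ∂(splitKernel κ m δ ν hC x) ≤
      2 ^ (1 - a) * ENNReal.ofReal δ ^ a * ∫⁻ X, hitFun C z φ n 0 X ∂(pathLaw κ x) := by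
  have hab1 : a + b ≤ 1 := by
    rw [hab, div_le_one (by linarith [hr.1])]; exact hr.1
  have h := lintegral_regFun_le κ (δ := δ) (ν := ν) hC hz hφ hsub
    (recursion_constants hδ hδ1 hr hab).le ?_ ?_ n x 0 0
  · simpa [hφ0] using h
  · intro x hx
    have h1 : ∀ w : Fin (m + 1) → S, splitDensity κ m C δ ν x (w (Fin.last m)) * φ (z w) =
        splitDensity κ m C δ ν x (w (Fin.last m)) * (1 ^ (0 : ℝ) * B (z w) ^ b) := fun w => by
      rw [hφB]; simp
    simp only [h1]
    have := lintegral_mul_rpow_mul_rpow_le (μ := blockLaw κ m x) (A := fun _ => 1)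
      (B := fun w => B (z w)) (measurable_splitDensity_last (m := m) κ δ ν hC x) measurable_const
      (hB.comp hz) (fun w => splitDensity_le_one κ m δ ν x _) le_rfl hb.le (by linarith)
      (lintegral_splitDensity κ m hδ hmin hx).le (by simp) (hBC x hx)
    simpa using this
  · intro x hx n
    have hDm := measurable_splitDensity_last (m := m) κ δ ν hC x
    have hmass := lintegral_one_sub_splitDensity κ m hC hδ hmin hx
    -- For `δ = 1` the exponent is `r = 1` and Hölder would give `0 ^ 0 = 1`. Instead the weight `1
    -- - D` vanishes almost everywhere, so the integral is `0`.
    split_ifs with h1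
    · rw [h1, sub_self, ENNReal.ofReal_zero, ← h1, lintegral_eq_zero_iff (by fun_prop)] at hmass
      refine le_of_eq ((lintegral_congr_ae ?_).trans lintegral_zero)
      filter_upwards [hmass] with w hw
      simp only [Pi.zero_apply] at hw
      rw [hw, zero_mul]
    · exact lintegral_weight_mul_le κ hC hz hφ hA hB ha hb.le hab1 hφA hφB (hAC x hx) (hBC x hx)
        (by fun_prop) (fun w => tsub_le_self) hmass.le n

theorem lintegral_splitLaw_regFun_le (hC : MeasurableSet C) (hδ : 0 < δ) (hδ1 : δ ≤ 1)
    (hmin : Minorizes κ m C δ ν) (hr : IsExponent δ r) (hz : Measurable z) (hφ : Measurable φ)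
    (hA : Measurable A) (hB : Measurable B) (ha : 0 < a) (hb : 0 < b) (hab : a + b = 1 / r)
    (hφA : ∀ s, A s ^ a = φ s) (hφB : ∀ s, B s ^ b = φ s)
    (hsub : ∀ s t, φ (s + t) ≤ φ s * φ t) (hφ0 : φ 0 = 1)
    (hAC : ∀ x ∈ C, ∀ n, ∫⁻ X, hitFun C z A n 0 (shiftPath m X) ∂(pathLaw κ x) ≤ 2)
    (hBC : ∀ x ∈ C, ∫⁻ w, B (z w) ∂(blockLaw κ m x) ≤ 2) (μ : Measure S)
    [IsProbabilityMeasure μ]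
    (hAμ : ∀ n, ∫⁻ X, hitFun C z A n 0 X ∂((pathLaw κ) ∘ₘ μ) ≤ 2) (n : ℕ) :
    ∫⁻ e, regFun z φ n 0 e ∂(splitLaw κ m hC δ ν μ) ≤ 2 := by
  have ha1 : a ≤ 1 := by
    have : a + b ≤ 1 := by rw [hab, div_le_one (by linarith [hr.1])]; exact hr.1
    linarith
  have hHm : Measurable fun X => hitFun C z φ n 0 X :=
    (measurable_hitFun hC hz hφ n).comp (f := fun X : ℕ → S => ((0 : ℝ), X)) (by fun_prop)
  rw [lintegral_splitLaw κ m δ ν hC μ (measurable_regFun_right hz hφ n 0)]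
  calc _ ≤ ∫⁻ x, 2 ^ (1 - a) * ENNReal.ofReal δ ^ a *
        ∫⁻ X, hitFun C z φ n 0 X ∂(pathLaw κ x) ∂μ := lintegral_mono fun x =>
          lintegral_regFun_le_hitFun hC hδ hδ1 hmin hr hz hφ hA hB ha hb hab hφA hφB hsub hφ0
            hAC hBC n x
    _ = 2 ^ (1 - a) * ENNReal.ofReal δ ^ a * ∫⁻ X, hitFun C z φ n 0 X ∂((pathLaw κ) ∘ₘ μ) := by
        rw [lintegral_const_mul _ hHm.lintegral_kernel,
          Measure.lintegral_bind (Kernel.aemeasurable _) hHm.aemeasurable]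
    _ ≤ 2 ^ (1 - a) * ENNReal.ofReal δ ^ a * 2 ^ a := by
        gcongr
        exact lintegral_hitFun_rpow_le κ hC hz hA ha ha1 hφA n (hAμ n)
    _ = 2 * ENNReal.ofReal δ ^ a := two_rpow_mul_rpow_mul _ _
    _ ≤ 2 * 1 := by
        gcongr
        exact ENNReal.rpow_le_one (by simpa using hδ1) ha.le
    _ = 2 := mul_one 2

/-- Keeping the weight `D` inside Hölder gains `δ^(1-a)`, which together with the `δ^a` in `g`
restores exactly the regeneration mass `δ`. Conditioning on a regeneration thus costs nothing beyond
the constant `2`. -/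
theorem lintegral_splitLaw_excFun_le (hC : MeasurableSet C) (hδ : 0 < δ) (hδ1 : δ ≤ 1)
    (hmin : Minorizes κ m C δ ν) (hr : IsExponent δ r) (hz : Measurable z) (hφ : Measurable φ)
    (hA : Measurable A) (hB : Measurable B) (ha : 0 < a) (hb : 0 < b) (hab : a + b = 1 / r)
    (hφA : ∀ s, A s ^ a = φ s) (hφB : ∀ s, B s ^ b = φ s)
    (hsub : ∀ s t, φ (s + t) ≤ φ s * φ t) (hφ0 : φ 0 = 1)
    (hAC : ∀ x ∈ C, ∀ n, ∫⁻ X, hitFun C z A n 0 (shiftPath m X) ∂(pathLaw κ x) ≤ 2)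
    (hBC : ∀ x ∈ C, ∫⁻ w, B (z w) ∂(blockLaw κ m x) ≤ 2) (μ : Measure S)
    [IsProbabilityMeasure μ] (n i : ℕ) :
    ∫⁻ e, excFun z φ n i e ∂(splitLaw κ m hC δ ν μ) ≤ 2 := by
  have ha1 : a ≤ 1 := by
    have : a + b ≤ 1 := by rw [hab, div_le_one (by linarith [hr.1])]; exact hr.1
    linarith
  rw [lintegral_splitLaw κ m δ ν hC μ (measurable_excFun hz hφ n i)]
  refine (lintegral_mono (g := fun _ => 2) fun x => ?_).trans (by simp)
  refine lintegral_excFun_le κ hC hz hφ (fun x n => ?_) n i x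
  by_cases hx : x ∈ C
  · have hDm := measurable_splitDensity_last (m := m) κ δ ν hC x
    have hHm := measurable_lintegral_hitFun κ hC hz hφ n 0
    rw [lintegral_splitDensity κ m hδ hmin hx]
    calc _ ≤ ∫⁻ w, 2 ^ (1 - a) * ENNReal.ofReal δ ^ a *
          (splitDensity κ m C δ ν x (w (Fin.last m)) *
            ∫⁻ X, hitFun C z φ n 0 X ∂(pathLaw κ (w (Fin.last m)))) ∂(blockLaw κ m x) := by
          refine lintegral_mono fun w => ?_
          rw [mul_left_comm]
          gcongr
          exact lintegral_regFun_le_hitFun hC hδ hδ1 hmin hr hz hφ hA hB ha hb hab hφA hφB hsub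
            hφ0 hAC hBC n _
      _ = 2 ^ (1 - a) * ENNReal.ofReal δ ^ a *
          ∫⁻ w, (splitDensity κ m C δ ν x (w (Fin.last m)) *
            ∫⁻ X, hitFun C z φ n 0 X ∂(pathLaw κ (w (Fin.last m)))) ∂(blockLaw κ m x) :=
          lintegral_const_mul _ (by fun_prop)
      _ ≤ 2 ^ (1 - a) * ENNReal.ofReal δ ^ a * (2 ^ a * ENNReal.ofReal δ ^ (1 - a)) := by
          gcongr
          exact lintegral_weight_mul_hitFun_le κ hC hz hφ hA ha ha1 hφA (hAC x hx) hDm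
            (fun w => splitDensity_le_one κ m δ ν x _) (lintegral_splitDensity κ m hδ hmin hx).le n
      _ = 2 * ENNReal.ofReal δ := by
          rw [← mul_assoc, two_rpow_mul_rpow_mul, mul_assoc,
            ← ENNReal.rpow_add _ _ (by simpa using hδ) ENNReal.ofReal_ne_top, add_sub_cancel,
            ENNReal.rpow_one]
  · simp [splitDensity_of_notMem κ m δ ν hx]

end Norms

/-! ### From moment bounds to Orlicz norms. -/

section Bounds

variable {S : Type*} [MeasurableSpace S] {κ : Kernel S S} [IsMarkovKernel κ] {m : ℕ} {C : Set S}
  {f : S → ℝ} {α : ℝ}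

/-- The exponents are forced: `a = k ^ α / c ^ α` and `b = d ^ α / c ^ α` turn both functions into
the one with parameter `c`, and `a + b = 1 / r` then determines `c`. -/
theorem expFun_exponents {α r k d : ℝ} (hα : 0 < α) (hr : 1 ≤ r) (hk : 0 < k) (hd : 0 < d) :
    ∃ c a b : ℝ, c = (r * (k ^ α + d ^ α)) ^ (1 / α) ∧ 0 < c ∧ 0 < a ∧ 0 < b ∧ a + b = 1 / r ∧
      (∀ s, expFun α k s ^ a = expFun α c s) ∧ (∀ s, expFun α d s ^ b = expFun α c s) := by
  have hk' := Real.rpow_pos_of_pos hk α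
  have hd' := Real.rpow_pos_of_pos hd α
  have hr0 : 0 < r := by linarith
  set Q := r * (k ^ α + d ^ α) with hQ
  have hQ0 : 0 < Q := by positivity
  have hc : (Q ^ (1 / α)) ^ α = Q := by
    rw [← Real.rpow_mul hQ0.le, one_div_mul_cancel hα.ne', Real.rpow_one]
  refine ⟨Q ^ (1 / α), k ^ α / Q, d ^ α / Q, rfl, by positivity, by positivity, by positivity, ?_,
    fun s => ?_, fun s => ?_⟩
  · rw [← add_div, hQ]
    field_simp
  · refine expFun_rpow _ _ _ _ _ ?_
    rw [hc]; field_simp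
  · refine expFun_rpow _ _ _ _ _ ?_
    rw [hc]; field_simp

theorem lintegral_expFun_blockSum_le (hf : Measurable f) (hα : 0 < α) {d : ℝ}
    (hd : calD κ m C f α < ENNReal.ofReal d) {x : S} (hx : x ∈ C) :
    ∫⁻ w : Fin (m + 1) → S, expFun α d (blockSum f w) ∂(blockLaw κ m x) ≤ 2 := by
  have h : psiNorm α (pathLaw κ x) (fun X => Z m f X 0) < ENNReal.ofReal d :=
    (le_iSup₂ (f := fun x (_ : x ∈ C) => psiNorm α (pathLaw κ x) fun X => Z m f X 0) x hx).trans_lt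
      hd
  have h2 := lintegral_expFun_le_two hα h
  have hm : Measurable fun w : Fin (m + 1) → S => expFun α d (blockSum f w) :=
    (measurable_expFun α d).comp (measurable_blockSum hf)
  rw [lintegral_blockLaw κ m x hm]
  have e : ∀ X : ℕ → S, shiftPath (0 * m) X = X := fun X => by funext i; simp
  simpa only [Z_eq_blockSum, e] using h2

theorem lintegral_hitFun_blockSum_le (hα : 0 < α) {k : ℝ}
    (hk : calC₀ κ m C f α < ENNReal.ofReal k) {x : S} (hx : x ∈ C) (n : ℕ) :
    ∫⁻ X, hitFun C (blockSum (m := m) f) (expFun α k) n 0 (shiftPath m X) ∂(pathLaw κ x) ≤ 2 := by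
  have h : psiNorm α (pathLaw κ x) (fun X => ∑ i ∈ Finset.Ico 1 (tauC m C X), Z m f X i) <
      ENNReal.ofReal k :=
    (le_iSup₂ (f := fun x (_ : x ∈ C) => psiNorm α (pathLaw κ x) fun X =>
      ∑ i ∈ Finset.Ico 1 (tauC m C X), Z m f X i) x hx).trans_lt hk
  have h2 := lintegral_expFun_le_two hα h
  simp only [Z_eq_blockSum] at h2
  exact (lintegral_mono fun X => hitFun_shiftPath_le n X).trans h2

theorem lintegral_hitFun_abs_blockSum_le (hα : 0 < α) {k : ℝ}
    (hk : calC κ m C f α < ENNReal.ofReal k) {x : S} (hx : x ∈ C) (n : ℕ) :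
    ∫⁻ X, hitFun C (fun w : Fin (m + 1) → S => |blockSum f w|) (expFun α k) n 0 (shiftPath m X)
      ∂(pathLaw κ x) ≤ 2 := by
  have h : psiNorm α (pathLaw κ x) (fun X => ∑ i ∈ Finset.Ico 1 (tauC m C X), |Z m f X i|) <
      ENNReal.ofReal k :=
    (le_iSup₂ (f := fun x (_ : x ∈ C) => psiNorm α (pathLaw κ x) fun X =>
      ∑ i ∈ Finset.Ico 1 (tauC m C X), |Z m f X i|) x hx).trans_lt hk
  have h2 := lintegral_expFun_le_two hα h
  simp only [Z_eq_blockSum] at h2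
  exact (lintegral_mono fun X => hitFun_shiftPath_le n X).trans h2

variable [MeasurableSpace.CountablyGenerated S] {δ r : ℝ} {ν : Measure S} [IsProbabilityMeasure ν]

theorem boldAB_le (hC : MeasurableSet C) (hδ : 0 < δ) (hδ1 : δ ≤ 1) (hm : 1 ≤ m)
    (hmin : Minorizes κ m C δ ν) (hrec : ∀ x, pathLaw κ x (avoiding m C 0) = 0)
    (hf : Measurable f) (hα : 0 < α) (hα1 : α ≤ 1) (hr : IsExponent δ r)
    (μ : Measure S) [IsProbabilityMeasure μ] :
    boldAB κ m hC δ ν f α μ ≤ ENNReal.ofReal (r ^ (1 / α)) *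
      ((max (calAB κ m C f α μ) (calC κ m C f α)) ^ α + (calD κ m C f α) ^ α) ^ (1 / α) := by
  refine le_ofReal_mul_of_forall_lt hα (by linarith [hr.1]) fun k d hk hd hK hD => ?_
  obtain ⟨c, a, b, hc, hc0, ha, hb, hab, hφA, hφB⟩ := expFun_exponents hα hr.1 hk hd
  rw [← hc]
  refine psiNorm_le hc0 ?_
  have hz : Measurable fun w : Fin (m + 1) → S => |blockSum f w| := by
    have := measurable_blockSum (m := m) hf
    fun_prop
  obtain ⟨hKA, hKC⟩ := max_lt_iff.1 hK
  refine lintegral_le_of_eventually_eq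
    (G := fun n e => regFun (fun w => |blockSum f w|) (expFun α c) n 0 e)
    (fun n => measurable_regFun_right hz (measurable_expFun α c) n 0) ?_ ?_
  · filter_upwards [ae_splitLaw_infinite κ hC hδ hmin hrec μ] with e he
    obtain ⟨h1, h2⟩ := sigma_zero_spec he.nonempty
    filter_upwards [Filter.eventually_gt_atTop (sigma e 0)] with n hn
    rw [regFun_eq _ _ _ 0 e h1 h2 n hn]
    simp only [Z_splitX_eq_blockSum hm, zero_add]
  · refine lintegral_splitLaw_regFun_le hC hδ hδ1 hmin hr hz (measurable_expFun α c)
      (measurable_expFun α k) (measurable_expFun α d) ha hb hab hφA hφB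
      (expFun_add_le hα hα1 hc0) (expFun_zero hα c)
      (fun x hx n => lintegral_hitFun_abs_blockSum_le hα hKC hx n) (fun x hx => ?_) μ fun n => ?_
    · simpa only [expFun_abs] using lintegral_expFun_blockSum_le hf hα hD hx
    · have h2 := lintegral_expFun_le_two hα hKA
      simp only [Z_eq_blockSum] at h2
      refine (lintegral_mono fun X => hitFun_le (fun s => ?_) n X).trans h2
      rw [expFun_zero hα]
      exact one_le_expFun hk s

/-- Here the moment bounds are run with signed block sums, which is why absolute values are not
needed in the excursion norm. For the sums starting at time `0` they are run with absolute block
sums. -/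
theorem boldC_le (hC : MeasurableSet C) (hδ : 0 < δ) (hδ1 : δ ≤ 1) (hm : 1 ≤ m)
    (hmin : Minorizes κ m C δ ν) (hrec : ∀ x, pathLaw κ x (avoiding m C 0) = 0)
    (hf : Measurable f) (hα : 0 < α) (hα1 : α ≤ 1) (hr : IsExponent δ r)
    (μ : Measure S) [IsProbabilityMeasure μ] (i : ℕ) :
    boldC κ m hC δ ν f α μ i ≤ ENNReal.ofReal (r ^ (1 / α)) *
      ((calC₀ κ m C f α) ^ α + (calD κ m C f α) ^ α) ^ (1 / α) := by
  refine le_ofReal_mul_of_forall_lt hα (by linarith [hr.1]) fun k d hk hd hK hD => ?_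
  obtain ⟨c, a, b, hc, hc0, ha, hb, hab, hφA, hφB⟩ := expFun_exponents hα hr.1 hk hd
  rw [← hc]
  refine psiNorm_le hc0 ?_
  have hz := measurable_blockSum (m := m) hf
  refine lintegral_le_of_eventually_eq
    (fun n => measurable_excFun hz (measurable_expFun α c) n i) ?_
    fun n => lintegral_splitLaw_excFun_le hC hδ hδ1 hmin hr hz (measurable_expFun α c)
      (measurable_expFun α k) (measurable_expFun α d) ha hb hab hφA hφB
      (expFun_add_le hα hα1 hc0) (expFun_zero hα c)
      (fun x hx n => lintegral_hitFun_blockSum_le hα hK hx n)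
      (fun x hx => lintegral_expFun_blockSum_le hf hα hD hx) μ n i
  filter_upwards [ae_splitLaw_infinite κ hC hδ hmin hrec μ] with e he
  simp only [excursionSum, Z_splitX_eq_blockSum hm]
  exact excFun_eventually_eq _ _ i e he

end Bounds

end SplitChain

end

theorem mainTheorem6 {S : Type*} [MeasurableSpace S] [MeasurableSpace.CountablyGenerated S]
    (P : Kernel S S) [IsMarkovKernel P] (π : Measure S) (hP : SplitChain.HarrisErgodic P π)
    (C : Set S) (hC : MeasurableSet C) (hπC : 0 < π C)
    (ν : Measure S) [IsProbabilityMeasure ν] (hνC : 0 < ν C)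
    (δ : ℝ) (hδ : 0 < δ) (m : ℕ) (hm : 1 ≤ m) (hmin : SplitChain.Minorizes P m C δ ν)
    (f : S → ℝ) (hf : Measurable f) (α : ℝ) (hα : 0 < α) (hα1 : α ≤ 1) :
    (∃! r : ℝ, SplitChain.IsExponent δ r) ∧
    ∀ r : ℝ, SplitChain.IsExponent δ r →
      (∀ x : S, SplitChain.boldAB P m hC δ ν f α (Measure.dirac x) ≤
        ENNReal.ofReal (r ^ (1 / α)) *
          ((max (SplitChain.calAB P m C f α (Measure.dirac x)) (SplitChain.calC P m C f α)) ^ α +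
            (SplitChain.calD P m C f α) ^ α) ^ (1 / α)) ∧
      SplitChain.boldAB P m hC δ ν f α π ≤
        ENNReal.ofReal (r ^ (1 / α)) *
          ((max (SplitChain.calAB P m C f α π) (SplitChain.calC P m C f α)) ^ α +
            (SplitChain.calD P m C f α) ^ α) ^ (1 / α) ∧
      (∀ (μ : Measure S) [IsProbabilityMeasure μ] (i : ℕ),
        SplitChain.boldC P m hC δ ν f α μ i ≤
          ENNReal.ofReal (r ^ (1 / α)) *
            ((SplitChain.calC₀ P m C f α) ^ α + (SplitChain.calD P m C f α) ^ α) ^ (1 / α)) := by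
  -- Evaluating the minorization on the whole space at a point of `C`, which exists since `π C > 0`,
  -- compares `δ` with `1`.
  have hδ1 : δ ≤ 1 := hmin.le_one (nonempty_of_measure_ne_zero hπC.ne')
  have hrec := fun x => hP.pathLaw_avoiding_eq_zero hC hπC hm x 0
  have hπ := hP.isProbabilityMeasure
  exact ⟨SplitChain.existsUnique_isExponent hδ hδ1, fun r hr =>
    ⟨fun x => SplitChain.boldAB_le hC hδ hδ1 hm hmin hrec hf hα hα1 hr _,
      SplitChain.boldAB_le hC hδ hδ1 hm hmin hrec hf hα hα1 hr π,
      fun μ _ i => SplitChain.boldC_le hC hδ hδ1 hm hmin hrec hf hα hα1 hr μ i⟩⟩
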